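/- For a finite multiset $I$ of item sizes in $[0,1]$ let $\mathrm{SIZE}(I)$ be the total size and let $\mathrm{OPT}(I)$ be the least number of unit-capacity bins into which $I$ can be packed (every bin has total size at most $1$). A high-multiplicity instance is a finite set of pairs (multiplicity, size) with distinct sizes; it is identified with the corresponding multiset of items. A deterministic one-pass streaming algorithm keeps a memory state that is a finite list of words; when an item arrives, the new state is determined by the old state and the item, and after the last item the output is computed from the state. After $N$ items have been read, every word contains either one of the item sizes read so far or an integer of $O(\log N)$ bits (absolute value at most $(N+2)^c$). The memory used on a stream is the largest number of words stored at any time while it is processed. Lemma. There are universal constants $C>0$ and $c\in\mathbb{N}$ such that for every $0<\varepsilon<1$ there is a deterministic one-pass streaming algorithm which, on every finite stream $I_B$ of big items (sizes in $(\varepsilon,1]$, in arbitrary order, the length not being known in advance), outputs a high-multiplicity bin packing instance $I_R$ such that, with $$\sigma = C\cdot\frac1\varepsilon\cdot\Bigl(1+\log\frac1\varepsilon\Bigr)\cdot\bigl(1+\log \mathrm{OPT}(I_B)\bigr)\qquad(\text{where } \log 0 := 0),$$ (P1) $I_R$ has at most $\sigma$ distinct item sizes, all of them in $(\varepsilon,1]$,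 and the memory used for processing $I_B$ is at most $\sigma$ words; (P2) $I_R$ and $I_B$ have the same number of items, and for every $i$ the $i$-th biggest item of $I_R$ is at least as large as the $i$-th biggest item of $I_B$; hence any packing of $I_R$ can be used as a packing of $I_B$ in the same number of bins (replacing, bin by bin, items by items that are not larger), $\mathrm{OPT}(I_B)\le \mathrm{OPT}(I_R)$ and $\mathrm{SIZE}(I_B)\le\mathrm{SIZE}(I_R)$; (P3) $\mathrm{OPT}(I_R)\le(1+\varepsilon)\,\mathrm{OPT}(I_B)+C\log\frac1\varepsilon$; (P4) $\mathrm{SIZE}(I_R)\le(1+\varepsilon)\,\mathrm{SIZE}(I_B)$. -/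

import Mathlib

/-! ### Bin packing -/

/-- `P` is a packing of the items `I` (a multiset of sizes) into unit bins: the bins of `P`
together contain exactly the items of `I`, and the total size in every bin is at most `1`. -/
def IsPacking (I : Multiset ℝ) (P : Multiset (Multiset ℝ)) : Prop :=
  P.join = I ∧ ∀ B ∈ P, B.sum ≤ 1

/-- `OPT(I)`: the least number of bins in a packing of `I`.
(A packing exists whenever all sizes are at most `1`, see `exists_isPacking`.) -/
noncomputable def OPT (I : Multiset ℝ) : ℕ :=
  sInf {m : ℕ | ∃ P : Multiset (Multiset ℝ), IsPacking I P ∧ P.card = m}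

/-- `SIZE(I)`: the total size of all items. -/
noncomputable def SIZE (I : Multiset ℝ) : ℝ := I.sum

/-- If all sizes are at most `1`, then one bin per item is a packing. -/
theorem exists_isPacking (I : Multiset ℝ) (h : ∀ x ∈ I, x ≤ 1) :
    ∃ P : Multiset (Multiset ℝ), IsPacking I P := by
  refine ⟨I.map fun x => {x}, ?_, ?_⟩
  · exact Multiset.bind_singleton I id |>.trans (Multiset.map_id I)
  · intro B hB
    obtain ⟨x, hx, rfl⟩ := Multiset.mem_map.1 hB
    simpa using h x hx

/-- An instance of high-multiplicity bin packing: finitely many distinct sizes (the support),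
each with its positive number of items. -/
abbrev HMInstance : Type := ℝ →₀ ℕ

/-- The items of a high-multiplicity instance, listed with multiplicity. -/
noncomputable def HMInstance.items (I : HMInstance) : Multiset ℝ := Finsupp.toMultiset I

/-- The number of distinct item sizes of a high-multiplicity instance. -/
def HMInstance.numSizes (I : HMInstance) : ℕ := I.support.card

/-- For every `i`, the `i`-th biggest item of `J` is at least as large as the `i`-th biggest item
of `I`, and both have the same number of items. -/
def RoundedUp (I J : Multiset ℝ) : Prop :=
  List.Forall₂ (· ≤ ·) (I.sort (· ≥ ·)) (J.sort (· ≥ ·))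

/-! ### Deterministic one-pass streaming algorithms -/

/-- A memory cell: it stores an item size or an integer (a counter, a pointer). -/
inductive MemWord : Type
  | item (x : ℝ) : MemWord
  | num (z : ℤ) : MemWord

/-- A deterministic one-pass streaming algorithm that outputs a high-multiplicity instance.
Its memory state is a list of words. On each arriving item the state is updated as a function of
the old state and the item alone; after the last item the output is computed from the state. -/
structure StreamAlg where
  /-- the state before the first item -/
  init : List MemWord
  /-- the update on the arrival of an item -/
  update : List MemWord → ℝ → List MemWord
  /-- the final computation -/
  output : List MemWord → HMInstance

/-- The memory state after reading the stream `s`. -/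
def StreamAlg.state (A : StreamAlg) (s : List ℝ) : List MemWord := s.foldl A.update A.init

/-- The output on the stream `s`. -/
def StreamAlg.result (A : StreamAlg) (s : List ℝ) : HMInstance := A.output (A.state s)

/-- What a word may contain after the items `s` have been read: an item size that occurred in `s`,
or an integer of `O(log N)` bits, where `N` is the number of items read (the `+ 2` covers
`N = 0, 1`). This rules out encoding several items in a single word. -/
def MemWord.Admissible (c : ℕ) (s : List ℝ) : MemWord → Prop
  | .item x => x ∈ s
  | .num z => |z| ≤ ((s.length : ℤ) + 2) ^ c

/-- At all times while `s` is processed, every word of the memory has admissible contents. -/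
def StreamAlg.Admissible (A : StreamAlg) (c : ℕ) (s : List ℝ) : Prop :=
  ∀ n ≤ s.length, ∀ w ∈ A.state (s.take n), w.Admissible c (s.take n)

/-- The memory used while `s` is processed: the largest number of words stored at any time. -/
def StreamAlg.memory (A : StreamAlg) (s : List ℝ) : ℕ :=
  (Finset.range (s.length + 1)).sup fun n => (A.state (s.take n)).length

/-! ### Packings and the optimum -/

/-! The rounding is an online quantile summary in the style of Greenwald and Khanna, kept separately
for each size class `(2^{-(j+1)}, 2^{-j}]`. A summary consists of clusters of items, each rounded up
to its largest member.

Rounding error. Above every threshold, the rounded class has at most `t = length / m` items more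
than the class (`Summarizes.countP_items_le`), so it splits into `t` items and a rest dominated by a
part of the class (`exists_split_of_countP_le`). Since `m ≥ 2/ε`, `t` is at most `ε/2` times the
class length, which is at most `2^{j+1}` times the class size. The `t` items fit `2^j` to a bin and
need at most `ε · SIZE` bins, plus one if `j > 0`. Summed over the classes this is `ε · OPT + O(log
(1/ε))`; class `0` costs no extra bin, so no additive constant survives as `ε` tends to `1`.

Memory. The clock `T` ticks once every `m` items of the class. The arrival time of an entry bounds
the number of smaller items represented by entries after it, and a cluster may grow as long as its
cardinality plus its time is at most `T`. Time stamps are grouped into bands of geometrically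
growing age, and entries merge only into entries of the same or an older band. When no merge is
possible, all but one of the entries of the band of age about `2^β` can each be charged to `2^β`
recent items, each item being used at most twice; only `O(2^β m)` items are recent. Hence there are
`O(m)` entries per band and `O(m log T)` per class (`Summary.length_le`). Items exceed `ε`, so `T ≤
OPT + 1`, which puts `log OPT` into the bound. -/

theorem IsPacking.OPT_le {I : Multiset ℝ} {P : Multiset (Multiset ℝ)} (h : IsPacking I P) :
    OPT I ≤ P.card :=
  Nat.sInf_le ⟨P, h, rfl⟩

theorem exists_isPacking_card_eq_OPT {I : Multiset ℝ} (h : ∀ x ∈ I, x ≤ 1) :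
    ∃ P, IsPacking I P ∧ P.card = OPT I := by
  obtain ⟨P, hP⟩ := exists_isPacking I h
  exact Nat.sInf_mem (s := {m : ℕ | ∃ P : Multiset (Multiset ℝ), IsPacking I P ∧ P.card = m})
    ⟨_, P, hP, rfl⟩

theorem OPT_zero : OPT 0 = 0 :=
  Nat.le_zero.1 (IsPacking.OPT_le (P := 0) ⟨by simp, by simp⟩)

theorem OPT_add_le {I J : Multiset ℝ} (hI : ∀ x ∈ I, x ≤ 1) (hJ : ∀ x ∈ J, x ≤ 1) :
    OPT (I + J) ≤ OPT I + OPT J := by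
  obtain ⟨P, ⟨hP, hP'⟩, hPc⟩ := exists_isPacking_card_eq_OPT hI
  obtain ⟨Q, ⟨hQ, hQ'⟩, hQc⟩ := exists_isPacking_card_eq_OPT hJ
  rw [← hPc, ← hQc, ← Multiset.card_add]
  refine IsPacking.OPT_le ⟨by rw [Multiset.join_add, hP, hQ], fun B hB => ?_⟩
  rcases Multiset.mem_add.1 hB with h | h
  exacts [hP' B h, hQ' B h]

theorem OPT_sum_le {ι : Type*} (s : Finset ι) (f : ι → Multiset ℝ)
    (h : ∀ i ∈ s, ∀ x ∈ f i, x ≤ 1) : OPT (∑ i ∈ s, f i) ≤ ∑ i ∈ s, OPT (f i) := by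
  classical
  induction s using Finset.induction_on with
  | empty => simp [OPT_zero]
  | insert a s ha ih =>
    rw [Finset.sum_insert ha, Finset.sum_insert ha]
    refine (OPT_add_le (h a (by simp)) fun x hx => ?_).trans
      (Nat.add_le_add_left (ih fun i hi => h i (by simp [hi])) _)
    obtain ⟨i, hi, hx⟩ := Multiset.mem_sum.1 hx
    exact h i (by simp [hi]) x hx

/-- A packing of items can be used for items that are related to them. -/
theorem exists_join_eq_of_rel {α β : Type*} {r : α → β → Prop} (P : Multiset (Multiset β)) :
    ∀ I : Multiset α, Multiset.Rel r I P.join →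
      ∃ Q : Multiset (Multiset α), Q.join = I ∧ Multiset.Rel (Multiset.Rel r) Q P := by
  induction P using Multiset.induction_on with
  | empty =>
    intro I hI
    rw [Multiset.join_zero, Multiset.rel_zero_right] at hI
    exact ⟨0, by simp [hI], Multiset.Rel.zero⟩
  | cons B P ih =>
    intro I hI
    rw [Multiset.join_cons, Multiset.rel_add_right] at hI
    obtain ⟨I₁, I₂, h₁, h₂, rfl⟩ := hI
    obtain ⟨Q, rfl, hQ⟩ := ih I₂ h₂
    exact ⟨I₁ ::ₘ Q, by simp, Multiset.Rel.cons h₁ hQ⟩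

theorem sum_le_sum_of_rel {I J : Multiset ℝ} (h : Multiset.Rel (· ≤ ·) I J) : I.sum ≤ J.sum :=
  Multiset.sum_le_sum_of_rel_le h

theorem IsPacking.exists_of_rel {I J : Multiset ℝ} (h : Multiset.Rel (· ≤ ·) I J)
    {P : Multiset (Multiset ℝ)} (hP : IsPacking J P) :
    ∃ Q, IsPacking I Q ∧ Multiset.Rel (Multiset.Rel (· ≤ ·)) Q P := by
  obtain ⟨Q, hQ, hQP⟩ := exists_join_eq_of_rel P I (by rwa [hP.1])
  refine ⟨Q, ⟨hQ, fun B hB => ?_⟩, hQP⟩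
  obtain ⟨B', hB', hBB'⟩ := Multiset.exists_mem_of_rel_of_mem hQP hB
  exact (sum_le_sum_of_rel hBB').trans (hP.2 B' hB')

theorem OPT_le_of_rel {I J : Multiset ℝ} (h : Multiset.Rel (· ≤ ·) I J) (hJ : ∀ x ∈ J, x ≤ 1) :
    OPT I ≤ OPT J := by
  obtain ⟨P, hP, hPc⟩ := exists_isPacking_card_eq_OPT hJ
  obtain ⟨Q, hQ, hQP⟩ := hP.exists_of_rel h
  rw [← hPc, ← Multiset.card_eq_card_of_rel hQP]
  exact hQ.OPT_le

/-- Each bin in turn keeps as much of `I` as it can; the rest of `I`, and what is left of `X`, is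
found in the remaining bins. -/
theorem exists_join_eq_of_join_eq_add {α : Type*} [DecidableEq α] (P : Multiset (Multiset α)) :
    ∀ I X : Multiset α, P.join = I + X →
      ∃ Q : Multiset (Multiset α), Q.join = I ∧ Multiset.Rel (· ≤ ·) Q P := by
  induction P using Multiset.induction_on with
  | empty =>
    intro I X h
    have : I = 0 := by
      have := congrArg Multiset.card h
      rw [Multiset.join_zero, Multiset.card_zero, Multiset.card_add] at this
      exact Multiset.card_eq_zero.1 (by omega)
    exact ⟨0, by simp [this], Multiset.Rel.zero⟩
  | cons B P ih =>
    intro I X h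
    rw [Multiset.join_cons] at h
    obtain ⟨Q, hQ, hQP⟩ := ih (I - B) (X - (B - I)) (by
      ext a
      have := congrArg (Multiset.count a) h
      simp only [Multiset.count_add, Multiset.count_sub] at this ⊢
      omega)
    refine ⟨(I ∩ B) ::ₘ Q, ?_, Multiset.Rel.cons Multiset.inter_le_right hQP⟩
    rw [Multiset.join_cons, hQ]
    ext a
    simp only [Multiset.count_add, Multiset.count_sub, Multiset.count_inter]
    omega

theorem OPT_mono {I J : Multiset ℝ} (h : I ≤ J) (hJ : ∀ x ∈ J, 0 ≤ x ∧ x ≤ 1) :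
    OPT I ≤ OPT J := by
  classical
  obtain ⟨X, rfl⟩ := Multiset.le_iff_exists_add.1 h
  obtain ⟨P, hP, hPc⟩ := exists_isPacking_card_eq_OPT fun x hx => (hJ x hx).2
  obtain ⟨Q, hQ, hQP⟩ := exists_join_eq_of_join_eq_add P I X hP.1
  rw [← hPc, ← Multiset.card_eq_card_of_rel hQP]
  refine IsPacking.OPT_le ⟨hQ, fun B hB => ?_⟩
  obtain ⟨B', hB', hBB'⟩ := Multiset.exists_mem_of_rel_of_mem hQP hB
  obtain ⟨Y, rfl⟩ := Multiset.le_iff_exists_add.1 hBB'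
  have hY : 0 ≤ Y.sum := Multiset.sum_nonneg fun y hy => by
    refine (hJ y ?_).1
    rw [← hP.1]
    exact Multiset.mem_join.2 ⟨_, hB', Multiset.mem_add.2 (Or.inr hy)⟩
  have := hP.2 _ hB'
  rw [Multiset.sum_add] at this
  linarith

theorem SIZE_le_OPT {I : Multiset ℝ} (h : ∀ x ∈ I, x ≤ 1) : SIZE I ≤ OPT I := by
  obtain ⟨P, ⟨hP, hP'⟩, hPc⟩ := exists_isPacking_card_eq_OPT h
  rw [← hPc, SIZE, ← hP, Multiset.sum_join]
  have := Multiset.sum_le_card_nsmul (P.map Multiset.sum) 1 (by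
    intro x hx
    obtain ⟨B, hB, rfl⟩ := Multiset.mem_map.1 hx
    exact hP' B hB)
  simpa using this

/-- Items of size at most `1 / q` can be packed `q` to a bin. -/
theorem mul_OPT_le {q : ℕ} (hq : 0 < q) (n : ℕ) :
    ∀ I : Multiset ℝ, I.card = n → (∀ x ∈ I, x ≤ 1 / q) → q * OPT I + 1 ≤ n + q := by
  induction n using Nat.strong_induction_on with
  | _ n ih =>
    intro I hI hx
    have hq' : (0 : ℝ) < q := by exact_mod_cast hq
    have h1 : (1 : ℝ) / q ≤ 1 := by
      rw [div_le_one hq']; exact_mod_cast hq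
    rcases Nat.eq_zero_or_pos n with rfl | hn
    · rw [Multiset.card_eq_zero] at hI
      rw [hI, OPT_zero]; omega
    have key : ∀ B : Multiset ℝ, (∀ x ∈ B, x ≤ 1 / q) → B.card ≤ q → OPT B ≤ 1 := by
      intro B hB hc
      refine IsPacking.OPT_le (P := {B}) ⟨by simp, fun B' hB' => ?_⟩
      rw [Multiset.mem_singleton.1 hB']
      refine (Multiset.sum_le_card_nsmul B _ hB).trans ?_
      rw [nsmul_eq_mul, mul_one_div, div_le_one hq']
      exact_mod_cast hc
    rcases le_total n q with hnq | hnq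
    · have := key I hx (hI.trans_le hnq)
      nlinarith
    · obtain ⟨B, J, rfl, hBc⟩ : ∃ B J : Multiset ℝ, I = B + J ∧ B.card = q := by
        induction I using Quotient.inductionOn with
        | _ l =>
          rw [Multiset.quot_mk_to_coe, Multiset.coe_card] at hI
          exact ⟨l.take q, l.drop q, by simp, by simp; omega⟩
      rw [Multiset.card_add] at hI
      have hJ := ih (n - q) (by omega) J (by omega) fun x hxJ => hx x (by simp [hxJ])
      have hB1 := key B (fun x hxB => hx x (by simp [hxB])) hBc.le
      have := OPT_add_le (I := B) (J := J) (fun x hxB => (hx x (by simp [hxB])).trans h1)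
        (fun x hxJ => (hx x (by simp [hxJ])).trans h1)
      nlinarith [Nat.sub_add_cancel hnq]

theorem card_mul_le_OPT {I : Multiset ℝ} {ε : ℝ} (h : ∀ x ∈ I, ε < x ∧ x ≤ 1) :
    I.card * ε ≤ OPT I := by
  refine le_trans ?_ (SIZE_le_OPT fun x hx => (h x hx).2)
  have := Multiset.card_nsmul_le_sum (s := I) (a := ε) fun x hx => (h x hx).1.le
  simpa [SIZE] using this

/-! ### Comparing sorted lists by counting -/

/-- Take `z = b[i + t]`: at least `i + t + 1` elements of `b` reach it, hence at least `i + 1`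
elements of `a`, and these come first in `a`. -/
theorem getElem_le_getElem_of_countP_le {a b : List ℝ} (ha : a.Pairwise (· ≥ ·))
    (hb : b.Pairwise (· ≥ ·)) {t : ℕ}
    (h : ∀ z : ℝ, b.countP (z ≤ ·) ≤ a.countP (z ≤ ·) + t) {i : ℕ} (hi : i + t < b.length) :
    ∃ h' : i < a.length, b[i + t] ≤ a[i] := by
  have hbz : i + t + 1 ≤ b.countP (b[i + t] ≤ ·) := by
    have h1 : (b.take (i + t + 1)).countP (b[i + t] ≤ ·) = (b.take (i + t + 1)).length := by
      rw [List.countP_eq_length]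
      intro x hx
      obtain ⟨k, hk, rfl⟩ := List.mem_iff_getElem.1 hx
      rw [List.length_take] at hk
      rw [List.getElem_take]
      rcases Nat.lt_or_ge k (i + t) with hk' | hk'
      · exact decide_eq_true (List.pairwise_iff_getElem.1 hb k (i + t) (by omega) hi hk')
      · obtain rfl : k = i + t := by omega
        simp
    have h2 := (List.take_sublist (i + t + 1) b).countP_le (p := (b[i + t] ≤ ·))
    rw [h1, List.length_take] at h2
    exact le_trans (by omega) h2
  have haz := h b[i + t]
  have hlen : i < a.length := by
    have := List.countP_le_length (p := (b[i + t] ≤ ·)) (l := a)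
    omega
  refine ⟨hlen, ?_⟩
  by_contra hlt
  rw [not_le] at hlt
  have h3 : (a.drop i).countP (b[i + t] ≤ ·) = 0 := by
    rw [List.countP_eq_zero]
    intro x hx
    obtain ⟨k, hk, rfl⟩ := List.mem_iff_getElem.1 hx
    rw [List.length_drop] at hk
    rw [List.getElem_drop]
    have : a[i + k] ≤ a[i] := by
      rcases Nat.eq_zero_or_pos k with rfl | hk'
      · simp
      · exact List.pairwise_iff_getElem.1 ha i (i + k) hlen (by omega) (by omega)
    simp; linarith
  have h4 : a.countP (b[i + t] ≤ ·) ≤ i := by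
    conv_lhs => rw [← List.take_append_drop i a]
    rw [List.countP_append, h3]
    exact le_trans (List.countP_le_length) (by simp)
  omega

theorem countP_le_of_rel {I J : Multiset ℝ} (h : Multiset.Rel (· ≤ ·) I J) (z : ℝ) :
    I.countP (z ≤ ·) ≤ J.countP (z ≤ ·) := by
  induction h with
  | zero => simp
  | @cons a b as bs hab _ ih =>
    rw [Multiset.countP_cons, Multiset.countP_cons]
    by_cases ha : z ≤ a
    · rw [if_pos ha, if_pos (ha.trans hab)]; omega
    · rw [if_neg ha]; omega

theorem countP_sort (I : Multiset ℝ) (z : ℝ) :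
    (I.sort (· ≥ ·)).countP (z ≤ ·) = I.countP (z ≤ ·) := by
  rw [← Multiset.coe_countP, Multiset.sort_eq]

theorem pairwise_sort_ge (I : Multiset ℝ) : (I.sort (· ≥ ·)).Pairwise (· ≥ ·) :=
  Multiset.pairwise_sort I (· ≥ ·)

theorem roundedUp_of_rel {I J : Multiset ℝ} (h : Multiset.Rel (· ≤ ·) I J) : RoundedUp I J := by
  have hc := Multiset.card_eq_card_of_rel h
  refine List.forall₂_iff_get.2 ⟨by simp [hc], fun i h₁ h₂ => ?_⟩
  obtain ⟨_, h'⟩ := getElem_le_getElem_of_countP_le (t := 0) (pairwise_sort_ge J)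
    (pairwise_sort_ge I) (fun z => by
      rw [countP_sort, countP_sort]; exact countP_le_of_rel h z) (i := i) h₁
  exact h'

theorem rel_coe_of_forall₂ {α β : Type*} {r : α → β → Prop} {a : List α} {b : List β}
    (h : List.Forall₂ r a b) : Multiset.Rel r (a : Multiset α) (b : Multiset β) := by
  induction h with
  | nil => exact Multiset.Rel.zero
  | cons h _ ih => exact Multiset.Rel.cons h ih

/-- If above every threshold `J` has at most `t` items more than `I`, then `J` without its `t`
biggest items is dominated by a part of `I`. -/
theorem exists_split_of_countP_le {I J : Multiset ℝ} {t : ℕ}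
    (h : ∀ z : ℝ, J.countP (z ≤ ·) ≤ I.countP (z ≤ ·) + t) :
    ∃ S R I' : Multiset ℝ, J = S + R ∧ S.card ≤ t ∧ I' ≤ I ∧ Multiset.Rel (· ≤ ·) R I' := by
  set a := I.sort (· ≥ ·) with ha
  set b := J.sort (· ≥ ·) with hb
  have key := fun i hi => getElem_le_getElem_of_countP_le (i := i) (pairwise_sort_ge I)
    (pairwise_sort_ge J) (fun z => by rw [countP_sort, countP_sort]; exact h z) hi
  have hlen : b.length ≤ a.length + t := by
    by_contra hlt
    obtain ⟨h', -⟩ := key a.length (by rw [← hb]; omega)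
    exact absurd h' (by rw [← ha]; omega)
  refine ⟨(b.take t : List ℝ), (b.drop t : List ℝ), (a.take (b.length - t) : List ℝ),
    ?_, ?_, ?_, ?_⟩
  · rw [Multiset.coe_add, List.take_append_drop, hb, Multiset.sort_eq]
  · simp
  · conv_rhs => rw [← Multiset.sort_eq I (· ≥ ·)]
    exact Multiset.coe_le.2 (List.take_sublist _ _).subperm
  · refine rel_coe_of_forall₂ (List.forall₂_iff_get.2 ⟨by simp; omega, fun i h₁ h₂ => ?_⟩)
    simp only [List.length_drop] at h₁
    obtain ⟨h', h''⟩ := key i (by rw [← hb]; omega)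
    simp only [List.get_eq_getElem, List.getElem_drop, List.getElem_take]
    simpa [Nat.add_comm] using h''

/-! ### A quantile summary -/

namespace Sketch

/-- An entry of the summary: a stored item, its time stamp, and the number of items of the stream
that it represents. -/
structure Entry where
  val : ℝ
  time : ℕ
  wt : ℕ

/-- An entry together with the (time-stamped) items that it represents. -/
structure Cluster where
  val : ℝ
  time : ℕ
  members : Multiset (ℝ × ℕ)

def Cluster.entry (c : Cluster) : Entry := ⟨c.val, c.time, c.members.card⟩

def members (G : List Cluster) : Multiset (ℝ × ℕ) := (G.map Cluster.members).sum

def weight (E : List Entry) : ℕ := (E.map Entry.wt).sum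

/-- The boundary between the time stamps of band `β + 1` and those of the bands up to `β`, at
time `T`. -/
def bnd (T β : ℕ) : ℕ := (T / 2 ^ β - 1) * 2 ^ β

@[simp] theorem members_nil : members [] = 0 := rfl

@[simp] theorem members_cons (c : Cluster) (G : List Cluster) :
    members (c :: G) = c.members + members G := by simp [members]

@[simp] theorem members_append (G H : List Cluster) :
    members (G ++ H) = members G + members H := by simp [members]

@[simp] theorem weight_nil : weight [] = 0 := rfl

@[simp] theorem weight_cons (e : Entry) (E : List Entry) :
    weight (e :: E) = e.wt + weight E := by simp [weight]

theorem weight_map_entry (G : List Cluster) :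
    weight (G.map Cluster.entry) = (members G).card := by
  induction G with
  | nil => simp
  | cons c G ih => simp [ih, Cluster.entry]

theorem mem_members {G : List Cluster} {y : ℝ × ℕ} :
    y ∈ members G ↔ ∃ c ∈ G, y ∈ c.members := by
  induction G with
  | nil => simp
  | cons c G ih => simp [ih]

/-! #### Boundaries -/

theorem bnd_zero (T : ℕ) : bnd T 0 = T - 1 := by simp [bnd]

theorem bnd_succ_le (T β : ℕ) : bnd T (β + 1) ≤ bnd T β := by
  have h : T / 2 ^ (β + 1) = T / 2 ^ β / 2 := by rw [pow_succ, Nat.div_div_eq_div_mul]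
  unfold bnd
  rw [h, pow_succ]
  generalize T / 2 ^ β = k
  rw [mul_comm (2 ^ β) 2, ← mul_assoc]
  exact Nat.mul_le_mul_right _ (by omega)

theorem bnd_antitone (T : ℕ) : Antitone (bnd T) := antitone_nat_of_succ_le (bnd_succ_le T)

/-- Together with `add_le_of_lt_bnd`, this ties boundaries to ages: stamps from the boundary on have
age below `2 * 2 ^ β`, earlier ones have age above `2 ^ β`. -/
theorem bnd_lt (T β : ℕ) : T < bnd T β + 2 * 2 ^ β := by
  have h := Nat.lt_mul_div_succ T (Nat.two_pow_pos β)
  unfold bnd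
  generalize T / 2 ^ β = k at *
  have : k + 1 ≤ (k - 1) + 2 := by omega
  nlinarith [Nat.mul_le_mul_left (2 ^ β) this]

theorem add_le_of_lt_bnd {T β s : ℕ} (h : s < bnd T β) : s + 1 + 2 ^ β ≤ T := by
  have h1 := Nat.div_mul_le_self T (2 ^ β)
  unfold bnd at h
  generalize T / 2 ^ β = k at *
  obtain _ | k := k
  · simp at h
  · simp only [Nat.add_sub_cancel] at h
    nlinarith

theorem bnd_log (T : ℕ) : bnd T (Nat.log 2 T) = 0 := by
  have h : T / 2 ^ Nat.log 2 T < 2 := by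
    rw [Nat.div_lt_iff_lt_mul (by positivity), ← pow_succ']
    exact Nat.lt_pow_succ_log_self (by norm_num) T
  unfold bnd
  rw [Nat.sub_eq_zero_of_le (by omega), zero_mul]

/-- The boundaries at time `T + 1` are boundaries at time `T`, up to a new one. -/
theorem bnd_succ_left (T β : ℕ) : (∃ β', bnd (T + 1) β = bnd T β') ∨ T ≤ bnd (T + 1) β := by
  obtain _ | β := β
  · right; simp [bnd_zero]
  left
  -- The boundary of level `β + 1` moves only when `2 ^ (β + 1)` divides `T + 1`, and then it lands
  -- on the old boundary of level `β`.
  by_cases hd : 2 ^ (β + 1) ∣ T + 1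
  · refine ⟨β, ?_⟩
    obtain ⟨k, hk⟩ := hd
    obtain _ | k := k
    · simp at hk
    have h1 : (T + 1) / 2 ^ (β + 1) = k + 1 := by
      rw [hk, Nat.mul_div_cancel_left _ (by positivity)]
    have h2 : T / 2 ^ β = 2 * k + 1 := by
      rw [Nat.div_eq_iff (by positivity)]
      have := Nat.two_pow_pos β
      rw [pow_succ] at hk
      have h3 : T + 1 = (2 * k + 1) * 2 ^ β + 2 ^ β := by rw [hk]; ring
      omega
    unfold bnd
    rw [h1, h2, pow_succ]
    simp only [Nat.add_sub_cancel]
    ring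
  · refine ⟨β + 1, ?_⟩
    unfold bnd
    rw [Nat.succ_div_of_not_dvd hd]

/-! #### Merging -/

/-- At time `T`, the entries `D` are merged into the next entry `P`. -/
inductive Merge (T : ℕ) : List Entry → List Entry → Prop
  | mk (A D : List Entry) (P : Entry) (F : List Entry) (hD : D ≠ [])
      (hw : weight D + P.wt + P.time ≤ T)
      -- Needed for `Summary.young`: the members that `P` takes over lie in no older band than `P`.
      (hP : ∀ d ∈ D, ∀ β, bnd T β ≤ P.time → bnd T β ≤ d.time)
      -- Needed for `Summary.block`: if the entry before `D` is younger than a boundary, so is `D`,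
      -- and `P` gains no member older than that boundary.
      (hA : ∀ q ∈ A.getLast?, ∀ d ∈ D, ∀ β, bnd T β ≤ q.time → bnd T β ≤ d.time) :
      Merge T (A ++ (D ++ P :: F)) (A ++ ⟨P.val, P.time, weight D + P.wt⟩ :: F)

theorem Merge.length_lt {T : ℕ} {E E' : List Entry} (h : Merge T E E') :
    E'.length < E.length := by
  obtain ⟨A, D, P, F, hD, -, -, -⟩ := h
  have := List.length_pos_iff.2 hD
  simp
  omega

def Irreducible (T : ℕ) (E : List Entry) : Prop := ∀ E', ¬ Merge T E E'

theorem exists_irreducible (T : ℕ) (E : List Entry) :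
    ∃ E', Relation.ReflTransGen (Merge T) E E' ∧ Irreducible T E' := by
  induction h : E.length using Nat.strong_induction_on generalizing E with
  | _ n ih =>
    by_cases hE : Irreducible T E
    · exact ⟨E, .refl, hE⟩
    · simp only [Irreducible, not_forall, not_not] at hE
      obtain ⟨E', hE'⟩ := hE
      obtain ⟨E'', h1, h2⟩ := ih _ (h ▸ hE'.length_lt) E' rfl
      exact ⟨E'', h1.head hE', h2⟩

/-! #### The invariant -/

/-- The invariant of the summary at time `T`. -/
structure Summary (T : ℕ) (G : List Cluster) : Prop where
  sorted : G.Pairwise (·.val ≤ ·.val)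
  self_mem : ∀ c ∈ G, (c.val, c.time) ∈ c.members
  le_val : ∀ c ∈ G, ∀ y ∈ c.members, y.1 ≤ c.val
  cap : ∀ c ∈ G, c.members.card + c.time ≤ T
  -- The time stamp doubles as the error bound of the entry, fixed at its arrival.
  cross : ∀ c E, c :: E <:+ G → (members E).countP (·.1 < c.val) ≤ c.time
  young : ∀ c ∈ G, ∀ y ∈ c.members, ∀ β, bnd T β ≤ c.time → bnd T β ≤ y.2
  -- When `u` arrived, `cap` for `P` gave this bound for all members of `P`; as long as `u`
  -- survives, `P` gains only members younger than the boundary.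
  block : ∀ u E, u :: E <:+ G → ∀ β P, bnd T β ≤ u.time →
    E.find? (·.time < bnd T β) = some P →
      P.members.countP (·.2 < bnd T β) + P.time ≤ u.time + 1

theorem cons_suffix_append {α : Type*} {u : α} {E A B : List α} (h : u :: E <:+ A ++ B) :
    u :: E <:+ B ∨ ∃ A', u :: A' <:+ A ∧ E = A' ++ B := by
  induction A with
  | nil => exact Or.inl h
  | cons a A ih =>
    rw [List.cons_append, List.suffix_cons_iff] at h
    rcases h with h | h
    · obtain ⟨rfl, rfl⟩ := List.cons.inj h
      exact Or.inr ⟨A, List.suffix_rfl, rfl⟩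
    · rcases ih h with h | ⟨A', h', rfl⟩
      · exact Or.inl h
      · exact Or.inr ⟨A', h'.trans (List.suffix_cons a A), rfl⟩

theorem cons_suffix_append_of_suffix {α : Type*} {u : α} {A' A : List α} (B : List α)
    (h : u :: A' <:+ A) : u :: (A' ++ B) <:+ A ++ B := by
  rw [← List.cons_append]
  exact List.suffix_append_self_iff.2 h

theorem Summary.nil (T : ℕ) : Summary T [] where
  sorted := List.Pairwise.nil
  self_mem := by simp
  le_val := by simp
  cap := by simp
  cross := by simp
  young := by simp
  block := by simp

theorem Summary.card_pos {T : ℕ} {G : List Cluster} (h : Summary T G) {c : Cluster} (hc : c ∈ G) :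
    1 ≤ c.members.card := Multiset.card_pos_iff_exists_mem.2 ⟨_, h.self_mem c hc⟩

theorem Summary.succ {T : ℕ} {G : List Cluster} (h : Summary T G) : Summary (T + 1) G where
  sorted := h.sorted
  self_mem := h.self_mem
  le_val := h.le_val
  cap c hc := (h.cap c hc).trans (Nat.le_succ T)
  cross := h.cross
  young c hc y hy β hβ := by
    have h1 := h.cap c hc
    have h2 := h.card_pos hc
    rcases bnd_succ_left T β with ⟨β', hβ'⟩ | h'
    · rw [hβ'] at hβ ⊢
      exact h.young c hc y hy β' hβ
    · omega
  block u E hu β P hβ hP := by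
    have hm : u ∈ G := hu.subset (by simp)
    have h1 := h.cap u hm
    have h2 := h.card_pos hm
    rcases bnd_succ_left T β with ⟨β', hβ'⟩ | h'
    · rw [hβ'] at hβ hP ⊢
      exact h.block u E hu β' P hβ hP
    · omega

theorem countP_lt_card {α : Type*} {p : α → Prop} [DecidablePred p] {s : Multiset α} {a : α}
    (ha : a ∈ s) (hp : ¬ p a) : s.countP p + 1 ≤ s.card := by
  obtain ⟨t, rfl⟩ := Multiset.exists_cons_of_mem ha
  rw [Multiset.countP_cons_of_neg _ hp, Multiset.card_cons]
  exact Nat.succ_le_succ (Multiset.countP_le_card _ _)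

theorem countP_le_countP {α : Type*} {p q : α → Prop} [DecidablePred p] [DecidablePred q]
    {s : Multiset α} (h : ∀ x ∈ s, p x → q x) : s.countP p ≤ s.countP q := by
  induction s using Multiset.induction_on with
  | empty => simp
  | cons a s ih =>
    have := ih fun x hx => h x (Multiset.mem_cons_of_mem hx)
    have ha := h a (Multiset.mem_cons_self a s)
    rw [Multiset.countP_cons, Multiset.countP_cons]
    split_ifs <;> first | omega | (exfalso; tauto)

/-- At most `T - 1` items below a threshold are represented by entries above it. -/
theorem Summary.cross_head {T : ℕ} {P : Cluster} {F : List Cluster} (h : Summary T (P :: F))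
    {z : ℝ} (hz : z ≤ P.val) : (members (P :: F)).countP (·.1 < z) + 1 ≤ T := by
  have h1 : P.members.countP (·.1 < z) + 1 ≤ P.members.card :=
    countP_lt_card (h.self_mem P (by simp)) (by simpa using hz)
  have h2 := h.cross P F List.suffix_rfl
  have h3 : (members F).countP (·.1 < z) ≤ (members F).countP (·.1 < P.val) :=
    countP_le_countP fun x _ hx => lt_of_lt_of_le hx hz
  have h4 := h.cap P (by simp)
  rw [members_cons, Multiset.countP_add]
  omega

theorem Summary.of_suffix {T : ℕ} {G H : List Cluster} (h : Summary T G) (hs : H <:+ G) :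
    Summary T H where
  sorted := h.sorted.sublist hs.sublist
  self_mem c hc := h.self_mem c (hs.subset hc)
  le_val c hc := h.le_val c (hs.subset hc)
  cap c hc := h.cap c (hs.subset hc)
  cross c E hE := h.cross c E (hE.trans hs)
  young c hc := h.young c (hs.subset hc)
  block u E hE := h.block u E (hE.trans hs)

theorem Summary.insert {T : ℕ} {A F : List Cluster} (h : Summary (T + 1) (A ++ F)) {x : ℝ}
    (hA : ∀ a ∈ A, a.val ≤ x) (hF : ∀ f ∈ F, x ≤ f.val) :
    Summary (T + 1) (A ++ ⟨x, T, {(x, T)}⟩ :: F) := by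
  have hmem : ∀ c, c ∈ A ++ (⟨x, T, {(x, T)}⟩ :: F : List Cluster) →
      c = ⟨x, T, {(x, T)}⟩ ∨ c ∈ A ++ F := by
    intro c hc
    simp only [List.mem_append, List.mem_cons] at hc ⊢
    tauto
  refine ⟨?_, ?_, ?_, ?_, ?_, ?_, ?_⟩
  · have := h.sorted
    rw [List.pairwise_append] at this ⊢
    refine ⟨this.1, List.pairwise_cons.2 ⟨hF, this.2.1⟩, fun a ha b hb => ?_⟩
    rcases List.mem_cons.1 hb with rfl | hb
    exacts [hA a ha, this.2.2 a ha b hb]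
  · intro c hc
    rcases hmem c hc with rfl | hc
    exacts [by simp, h.self_mem c hc]
  · intro c hc
    rcases hmem c hc with rfl | hc
    exacts [by simp, h.le_val c hc]
  · intro c hc
    rcases hmem c hc with rfl | hc
    exacts [by simp; omega, h.cap c hc]
  · intro c E hE
    rcases cons_suffix_append hE with hE | ⟨A', hA', rfl⟩
    · rcases List.suffix_cons_iff.1 hE with hE | hE
      · obtain ⟨rfl, rfl⟩ := List.cons.inj hE
        obtain _ | ⟨P, F⟩ := E
        · simp
        -- At clock `T + 1` fewer than `T + 1` items below `x` are represented by `F`, so the stamp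
        -- `T` is a valid error bound.
        · have := (h.of_suffix (List.suffix_append A (P :: F))).cross_head (hF P (by simp))
          simpa using this
      · exact h.cross c E (List.suffix_append_of_suffix hE)
    · have h1 := h.cross c _ (cons_suffix_append_of_suffix F hA')
      have h2 := hA c (hA'.subset (by simp))
      have h3 : ¬ x < c.val := not_lt.2 h2
      simp only [members_append, members_cons, Multiset.countP_add] at h1 ⊢
      have h4 : ({(x, T)} : Multiset (ℝ × ℕ)).countP (·.1 < c.val) = 0 :=
        Multiset.countP_eq_zero.2 fun y hy => by rwa [Multiset.mem_singleton.1 hy]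
      rw [h4, zero_add]
      exact h1
  · intro c hc
    rcases hmem c hc with rfl | hc
    · intro y hy β hβ
      rw [Multiset.mem_singleton.1 hy]
      exact hβ
    · exact h.young c hc
  · intro u E hE β P hu hP
    rcases cons_suffix_append hE with hE | ⟨A', hA', rfl⟩
    · rcases List.suffix_cons_iff.1 hE with hE | hE
      · obtain ⟨rfl, rfl⟩ := List.cons.inj hE
        have h1 := h.cap P (List.mem_append_right _ (List.mem_of_find?_eq_some hP))
        have h2 := Multiset.countP_le_card (·.2 < bnd (T + 1) β) P.members
        show _ ≤ T + 1
        omega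
      · exact h.block u E (List.suffix_append_of_suffix hE) β P hu hP
    · refine h.block u _ (cons_suffix_append_of_suffix F hA') β P hu ?_
      have hm : u ∈ A ++ F := List.mem_append_left _ (hA'.subset (by simp))
      have h1 := h.cap u hm
      have h2 := h.card_pos hm
      -- The new stamp `T` is no smaller than `u.time`, hence not before the boundary, so the search
      -- passes over the new entry.
      rw [List.find?_append, List.find?_cons_of_neg (by simp; omega)] at hP
      rw [List.find?_append]
      exact hP

theorem Summary.merge {T : ℕ} {A D F : List Cluster} {P : Cluster}
    (h : Summary T (A ++ (D ++ P :: F)))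
    (hw : (members D).card + P.members.card + P.time ≤ T)
    (hP : ∀ d ∈ D, ∀ β, bnd T β ≤ P.time → bnd T β ≤ d.time)
    (hA : ∀ q ∈ A.getLast?, ∀ d ∈ D, ∀ β, bnd T β ≤ q.time → bnd T β ≤ d.time) :
    Summary T (A ++ ⟨P.val, P.time, members D + P.members⟩ :: F) := by
  have hDm : ∀ d ∈ D, d ∈ A ++ (D ++ P :: F) := by simp +contextual
  have hPm : P ∈ A ++ (D ++ P :: F) := by simp
  have hmem : ∀ c, c ∈ A ++ (⟨P.val, P.time, members D + P.members⟩ :: F : List Cluster) →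
      c = ⟨P.val, P.time, members D + P.members⟩ ∨ c ∈ A ++ (D ++ P :: F) := by
    intro c hc
    simp only [List.mem_append, List.mem_cons] at hc ⊢
    tauto
  have hsF : P :: F <:+ A ++ (D ++ P :: F) :=
    List.suffix_append_of_suffix (List.suffix_append _ _)
  refine ⟨?_, ?_, ?_, ?_, ?_, ?_, ?_⟩
  · have := h.sorted
    rw [List.pairwise_append, List.pairwise_append] at this
    obtain ⟨h1, ⟨-, h2, -⟩, h3⟩ := this
    rw [List.pairwise_cons] at h2
    rw [List.pairwise_append, List.pairwise_cons]
    refine ⟨h1, h2, fun a ha b hb => ?_⟩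
    rcases List.mem_cons.1 hb with rfl | hb
    exacts [h3 a ha P (by simp), h3 a ha b (by simp [hb])]
  · intro c hc
    rcases hmem c hc with rfl | hc
    exacts [Multiset.mem_add.2 (Or.inr (h.self_mem P hPm)), h.self_mem c hc]
  · intro c hc
    rcases hmem c hc with rfl | hc
    · intro y hy
      rcases Multiset.mem_add.1 hy with hy | hy
      · obtain ⟨d, hd, hy⟩ := mem_members.1 hy
        have h1 := h.sorted
        rw [List.pairwise_append, List.pairwise_append] at h1
        exact (h.le_val d (hDm d hd) y hy).trans (h1.2.1.2.2 d hd P (by simp))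
      · exact h.le_val P hPm y hy
    · exact h.le_val c hc
  · intro c hc
    rcases hmem c hc with rfl | hc
    exacts [by simpa using hw, h.cap c hc]
  · intro c E hE
    rcases cons_suffix_append hE with hE | ⟨A', hA', rfl⟩
    · rcases List.suffix_cons_iff.1 hE with hE | hE
      · obtain ⟨rfl, rfl⟩ := List.cons.inj hE
        exact h.cross P E hsF
      · exact h.cross c E ((hE.trans (List.suffix_cons P F)).trans hsF)
    · have h1 := h.cross c _ (cons_suffix_append_of_suffix (D ++ P :: F) hA')
      simpa [add_assoc] using h1
  · intro c hc
    rcases hmem c hc with rfl | hc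
    · intro y hy β hβ
      rcases Multiset.mem_add.1 hy with hy | hy
      · obtain ⟨d, hd, hy⟩ := mem_members.1 hy
        exact h.young d (hDm d hd) y hy β (hP d hd β hβ)
      · exact h.young P hPm y hy β hβ
    · exact h.young c hc
  · intro u E hE β Q hu hQ
    rcases cons_suffix_append hE with hE | ⟨A', hA', rfl⟩
    · rcases List.suffix_cons_iff.1 hE with hE | hE
      · obtain ⟨rfl, rfl⟩ := List.cons.inj hE
        exact h.block P E hsF β Q hu hQ
      · exact h.block u E ((hE.trans (List.suffix_cons P F)).trans hsF) β Q hu hQ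
    · have key := h.block u _ (cons_suffix_append_of_suffix (D ++ P :: F) hA') β
      rw [List.find?_append] at hQ key
      obtain hf | ⟨R, hf⟩ := Option.eq_none_or_eq_some (A'.find? (·.time < bnd T β))
      swap
      · rw [hf] at hQ key
        exact key Q hu hQ
      rw [hf, Option.none_or] at hQ key
      have hf' : ∀ a ∈ A', bnd T β ≤ a.time := by simpa using hf
      -- If the search stops at `P`, then all entries from `u` to the end of `A` are younger than
      -- the boundary, and `hA` makes `D` younger too: the count of old members is unchanged.
      -- Otherwise `hP` makes the search pass over `D` as it does over `P`.
      by_cases hPb : P.time < bnd T β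
      · rw [List.find?_cons_of_pos (by simpa using hPb)] at hQ
        obtain rfl := Option.some.inj hQ
        have hlast : ∃ q ∈ A.getLast?, bnd T β ≤ q.time := by
          obtain ⟨A₀, rfl⟩ := hA'
          rw [List.getLast?_append_of_ne_nil _ (by simp)]
          refine ⟨(u :: A').getLast (by simp), List.getLast?_eq_getLast_of_ne_nil _, ?_⟩
          rcases List.mem_cons.1 (List.getLast_mem (l := u :: A') (by simp)) with h' | h'
          · rw [h']; exact hu
          · exact hf' _ h'
        obtain ⟨q, hq, hqb⟩ := hlast
        have hD : ∀ d ∈ D, bnd T β ≤ d.time := fun d hd => hA q hq d hd β hqb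
        have hfD : D.find? (·.time < bnd T β) = none := by simpa using hD
        rw [List.find?_append, hfD, Option.none_or,
          List.find?_cons_of_pos (by simpa using hPb)] at key
        have h0 : (members D).countP (·.2 < bnd T β) = 0 := by
          rw [Multiset.countP_eq_zero]
          intro y hy
          obtain ⟨d, hd, hy⟩ := mem_members.1 hy
          exact not_lt.2 (h.young d (hDm d hd) y hy β (hD d hd))
        have := key P hu rfl
        simpa [Multiset.countP_add, h0] using this
      · have hfD : D.find? (·.time < bnd T β) = none := by
          simpa using fun d hd => hP d hd β (not_lt.1 hPb)
        rw [List.find?_append, hfD, Option.none_or,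
          List.find?_cons_of_neg (by simpa using hPb)] at key
        rw [List.find?_cons_of_neg (by simpa using hPb)] at hQ
        exact key Q hu hQ

/-! #### Size of irreducible summaries -/

/-- A charging argument: an element with `ex` is charged to the stretch from just after the previous
`old` element through the next one. Each weight lies in at most two such stretches, hence the factor
`2`; the last `old` element has no next one and is paid for by the summand `k`. -/
theorem mul_countP_suffix_le {α : Type*} {old ex : α → Bool} {w : α → ℕ} {k : ℕ} {G : List α}
    (hex : ∀ a, ex a → old a)
    (H : ∀ A R u R' P E, G = A ++ (R ++ u :: (R' ++ P :: E)) → (∀ q ∈ A.getLast?, old q) →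
      (∀ r ∈ R, ¬ old r) → (∀ r ∈ R', ¬ old r) → old u → old P → ex u →
      k ≤ (R.map w).sum + w u + (R'.map w).sum + w P) (n : ℕ) :
    ∀ S : List α, S.length = n → ∀ A R u, G = A ++ (R ++ u :: S) → (∀ q ∈ A.getLast?, old q) →
      (∀ r ∈ R, ¬ old r) → old u →
      k * (u :: S).countP ex ≤ (R.map w).sum + w u + 2 * (S.map w).sum + k := by
  induction n using Nat.strong_induction_on with
  | _ n ih =>
    intro S hS A R u hG hA hR hu
    obtain hf | ⟨P, hf⟩ := Option.eq_none_or_eq_some (S.find? old)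
    · have h0 : S.countP ex = 0 := by
        rw [List.countP_eq_zero]
        intro a ha hea
        exact List.find?_eq_none.1 hf a ha (hex a hea)
      rw [List.countP_cons, h0]
      split_ifs <;> simp
    · obtain ⟨hP, R', E, rfl, hR'⟩ := List.find?_eq_some_iff_append.1 hf
      have hR'' : ∀ r ∈ R', ¬ old r := by simpa using hR'
      have h1 := ih E.length (by subst hS; simp; omega) E rfl (A ++ (R ++ [u])) R' P
        (by simp [hG]) (by simp; exact hu) hR'' hP
      have h2 := H A R u R' P E hG hA hR hR'' hu hP
      have h0 : R'.countP ex = 0 := by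
        rw [List.countP_eq_zero]
        intro a ha hea
        exact hR'' a ha (hex a hea)
      rw [List.countP_cons, List.countP_append, h0, zero_add, mul_add]
      simp only [List.map_append, List.map_cons, List.sum_append, List.sum_cons]
      split_ifs with hu'
      · have := h2 hu'
        omega
      · omega

theorem mul_countP_le {α : Type*} {old ex : α → Bool} {w : α → ℕ} {k : ℕ} {G : List α}
    (hex : ∀ a, ex a → old a)
    (H : ∀ A R u R' P E, G = A ++ (R ++ u :: (R' ++ P :: E)) → (∀ q ∈ A.getLast?, old q) →
      (∀ r ∈ R, ¬ old r) → (∀ r ∈ R', ¬ old r) → old u → old P → ex u →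
      k ≤ (R.map w).sum + w u + (R'.map w).sum + w P) :
    k * G.countP ex ≤ 2 * (G.map w).sum + k := by
  obtain hf | ⟨P, hf⟩ := Option.eq_none_or_eq_some (G.find? old)
  · have h0 : G.countP ex = 0 := by
      rw [List.countP_eq_zero]
      intro a ha hea
      exact List.find?_eq_none.1 hf a ha (hex a hea)
    simp [h0]
  · obtain ⟨hP, R, S, rfl, hR⟩ := List.find?_eq_some_iff_append.1 hf
    have hR' : ∀ r ∈ R, ¬ old r := by simpa using hR
    have h1 := mul_countP_suffix_le hex H S.length S rfl [] R P rfl (by simp) hR' hP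
    have h0 : R.countP ex = 0 := by
      rw [List.countP_eq_zero]
      intro a ha hea
      exact hR' a ha (hex a hea)
    rw [List.countP_append, h0, zero_add]
    simp only [List.map_append, List.map_cons, List.sum_append, List.sum_cons]
    omega

theorem countP_members (p : ℝ × ℕ → Prop) [DecidablePred p] (G : List Cluster) :
    (members G).countP p = (G.map fun c => c.members.countP p).sum := by
  induction G with
  | nil => simp
  | cons c G ih => simp [ih]

theorem Summary.countP_young {T : ℕ} {G : List Cluster} (h : Summary T G) {c : Cluster}
    (hc : c ∈ G) {β : ℕ} (hβ : bnd T β ≤ c.time) :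
    c.members.countP (bnd T β ≤ ·.2) = c.members.card :=
  Multiset.countP_eq_card.2 fun y hy => h.young c hc y hy β hβ

/-- The number of entries in a band is bounded in terms of the number of recent items. -/
theorem Summary.mul_countP_band_le {T : ℕ} {G : List Cluster} (h : Summary T G)
    (hirr : Irreducible T (G.map Cluster.entry)) (β : ℕ) :
    2 ^ β * G.countP (fun c => bnd T (β + 1) ≤ c.time ∧ c.time < bnd T β) ≤
      2 * (members G).countP (bnd T (β + 1) ≤ ·.2) + 2 ^ β := by
  rw [countP_members]
  generalize hk : 2 ^ β = k
  have key := mul_countP_le (G := G) (k := k) (old := fun c : Cluster => decide (c.time < bnd T β))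
    (ex := fun c : Cluster => decide (bnd T (β + 1) ≤ c.time ∧ c.time < bnd T β))
    (w := fun c : Cluster => c.members.countP (bnd T (β + 1) ≤ ·.2))
    (fun c hc => decide_eq_true (of_decide_eq_true hc).2)
  refine key ?_
  subst hk
  intro A R u R' P E hG hA hR hR' hu hP hex
  simp only [decide_eq_true_eq, not_lt] at hA hR hR' hu hP hex
  have hb := bnd_succ_le T β
  have hsub : ∀ c ∈ R ++ u :: R', c ∈ G ∧ bnd T (β + 1) ≤ c.time := by
    intro c hc
    have : c ∈ R ∨ c = u ∨ c ∈ R' := by simpa using hc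
    refine ⟨by rw [hG]; simp; tauto, ?_⟩
    rcases this with hc | rfl | hc
    exacts [hb.trans (hR c hc), hex.1, hb.trans (hR' c hc)]
  have hPG : P ∈ G := by rw [hG]; simp
  -- A stamp before boundary `β` can only lie past boundaries of index above `β`, and these are at
  -- most the boundary `β + 1`.
  have hband : ∀ s, s < bnd T β → ∀ β', bnd T β' ≤ s → bnd T β' ≤ bnd T (β + 1) := by
    intro s hs β' hβ'
    refine bnd_antitone T ?_
    by_contra hlt
    have := bnd_antitone T (show β' ≤ β by omega)
    omega
  -- Merging the stretch `R ++ u :: R'` into `P` satisfies both band conditions, since `P` and the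
  -- last entry of `A` are old. By irreducibility the weight condition must fail.
  have hw : T < (members (R ++ u :: R')).card + P.members.card + P.time := by
    by_contra hle
    refine hirr (A.map Cluster.entry ++ ⟨P.val, P.time,
      weight ((R ++ u :: R').map Cluster.entry) + P.members.card⟩ :: E.map Cluster.entry) ?_
    rw [hG, List.map_append, show R ++ u :: (R' ++ P :: E) = (R ++ u :: R') ++ P :: E by simp,
      List.map_append (l₁ := R ++ u :: R'), List.map_cons]
    refine Merge.mk _ _ P.entry _ (by simp) ?_ ?_ ?_
    · rw [weight_map_entry]
      exact not_lt.1 hle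
    · intro d hd β' hβ'
      obtain ⟨c, hc, rfl⟩ := List.mem_map.1 hd
      exact (hband P.time hP β' hβ').trans (hsub c hc).2
    · intro q hq d hd β' hβ'
      rw [List.getLast?_map] at hq
      obtain ⟨q', hq', rfl⟩ := Option.mem_map.1 hq
      obtain ⟨c, hc, rfl⟩ := List.mem_map.1 hd
      exact (hband q'.time (hA q' hq') β' hβ').trans (hsub c hc).2
  have hyoung : (members (R ++ u :: R')).countP (bnd T (β + 1) ≤ ·.2) =
      (members (R ++ u :: R')).card := by
    rw [Multiset.countP_eq_card]
    intro y hy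
    obtain ⟨c, hc, hy⟩ := mem_members.1 hy
    exact h.young c (hsub c hc).1 y hy _ (hsub c hc).2
  have hsum : (members (R ++ u :: R')).countP (bnd T (β + 1) ≤ ·.2) =
      (R.map fun c => c.members.countP (bnd T (β + 1) ≤ ·.2)).sum +
        u.members.countP (bnd T (β + 1) ≤ ·.2) +
        (R'.map fun c => c.members.countP (bnd T (β + 1) ≤ ·.2)).sum := by
    rw [countP_members]
    simp [add_assoc]
  rw [← hsum, hyoung]
  -- If `P` lies in the band itself, all its members are recent and its age exceeds `2 ^ β`.
  -- Otherwise `block` bounds its non-recent members plus `P.time` by `u.time + 1`, and the age of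
  -- `u` takes over.
  rcases le_or_gt (bnd T (β + 1)) P.time with hPb | hPb
  · rw [h.countP_young hPG hPb]
    have := add_le_of_lt_bnd hP
    omega
  · have h1 := h.block u (R' ++ P :: E) ⟨A ++ R, by simp [hG]⟩ (β + 1) P hex.1 (by
      have : R'.find? (·.time < bnd T (β + 1)) = none := by
        simpa using fun c hc => hb.trans (hR' c hc)
      rw [List.find?_append, this, Option.none_or, List.find?_cons_of_pos (by simpa using hPb)])
    have h2 := Multiset.card_eq_countP_add_countP (bnd T (β + 1) ≤ ·.2) P.members
    simp only [not_le] at h2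
    have := add_le_of_lt_bnd hu
    omega

/-- The stamps from boundary `β + 1` on span fewer than `4 * 2 ^ β` ticks of at most `m` items each;
the factor `2` of the charging argument makes this `8 * m`. -/
theorem Summary.countP_band_le {T m : ℕ} {G : List Cluster} (h : Summary T G)
    (hirr : Irreducible T (G.map Cluster.entry))
    (hm : ∀ b, (members G).countP (b ≤ ·.2) ≤ (T - b) * m) (β : ℕ) :
    G.countP (fun c => bnd T (β + 1) ≤ c.time ∧ c.time < bnd T β) ≤ 8 * m + 1 := by
  have h1 := h.mul_countP_band_le hirr β
  have h2 := hm (bnd T (β + 1))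
  have h3 := bnd_lt T (β + 1)
  have h4 : (T - bnd T (β + 1)) * m ≤ (4 * 2 ^ β) * m :=
    Nat.mul_le_mul_right _ (by rw [pow_succ] at h3; omega)
  refine Nat.le_of_mul_le_mul_left ?_ (Nat.two_pow_pos β)
  refine h1.trans ?_
  calc _ ≤ 2 * ((4 * 2 ^ β) * m) + 2 ^ β := by omega
    _ = _ := by ring

/-- The stamp `T - 1` accounts for at most `m` entries, each further boundary adds one band, and the
boundary of index `Nat.log 2 T` is `0`, so every entry is counted. -/
theorem Summary.length_le {T m : ℕ} {G : List Cluster} (h : Summary T G)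
    (hirr : Irreducible T (G.map Cluster.entry))
    (hm : ∀ b, (members G).countP (b ≤ ·.2) ≤ (T - b) * m) :
    G.length ≤ m + Nat.log 2 T * (8 * m + 1) := by
  have key : ∀ β, G.countP (fun c => bnd T β ≤ c.time) ≤ m + β * (8 * m + 1) := by
    intro β
    induction β with
    | zero =>
      have h1 := hm (bnd T 0)
      have h2 : (T - bnd T 0) * m ≤ 1 * m := Nat.mul_le_mul_right _ (by rw [bnd_zero]; omega)
      have h3 : G.countP (fun c => bnd T 0 ≤ c.time) ≤ (members G).countP (bnd T 0 ≤ ·.2) := by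
        have : ∀ H : List Cluster, (∀ c ∈ H, c ∈ G) →
            H.countP (fun c => bnd T 0 ≤ c.time) ≤ (members H).countP (bnd T 0 ≤ ·.2) := by
          intro H
          induction H with
          | nil => simp
          | cons c H ih =>
            intro hH
            have h4 := ih fun d hd => hH d (by simp [hd])
            rw [members_cons, Multiset.countP_add, List.countP_cons]
            split_ifs with hc
            · have h5 := h.countP_young (hH c (by simp)) (of_decide_eq_true hc)
              have h6 := h.card_pos (hH c (by simp))
              omega
            · omega
        exact this G fun c hc => hc
      omega
    | succ β ih =>
      have h1 := h.countP_band_le hirr hm β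
      have h2 : ∀ H : List Cluster, H.countP (fun c => bnd T (β + 1) ≤ c.time) ≤
          H.countP (fun c => bnd T β ≤ c.time) +
          H.countP (fun c => bnd T (β + 1) ≤ c.time ∧ c.time < bnd T β) := by
        intro H
        induction H with
        | nil => simp
        | cons c H ih =>
          simp only [List.countP_cons, decide_eq_true_eq]
          split_ifs <;> omega
      have h3 := h2 G
      calc _ ≤ _ := h3
        _ ≤ (m + β * (8 * m + 1)) + (8 * m + 1) := by omega
        _ = _ := by ring
  have := key (Nat.log 2 T)
  simpa [bnd_log] using this

/-! #### Processing an item -/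

theorem Summary.exists_of_merge {T : ℕ} {G : List Cluster} (h : Summary T G) {E' : List Entry}
    (hE : Merge T (G.map Cluster.entry) E') :
    ∃ G', G'.map Cluster.entry = E' ∧ Summary T G' ∧ members G' = members G := by
  generalize hE₀ : G.map Cluster.entry = E at hE
  obtain ⟨A, D, P, F, -, hw, hP, hA⟩ := hE
  obtain ⟨A, G₁, rfl, rfl, hG₁⟩ := List.map_eq_append_iff.1 hE₀
  obtain ⟨D, G₂, rfl, rfl, hG₂⟩ := List.map_eq_append_iff.1 hG₁
  obtain ⟨P, F, rfl, rfl, rfl⟩ := List.map_eq_cons_iff.1 hG₂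
  rw [weight_map_entry] at hw
  refine ⟨A ++ ⟨P.val, P.time, members D + P.members⟩ :: F, ?_, h.merge hw ?_ ?_, ?_⟩
  · simp [Cluster.entry, weight_map_entry]
  · exact fun d hd => hP d.entry (List.mem_map_of_mem hd)
  · intro q hq d hd
    refine hA q.entry ?_ d.entry (List.mem_map_of_mem hd)
    rw [List.getLast?_map]
    exact Option.mem_map_of_mem _ hq
  · simp [add_assoc]

theorem Summary.exists_of_reflTransGen {T : ℕ} {E E' : List Entry}
    (hE : Relation.ReflTransGen (Merge T) E E') :
    ∀ G : List Cluster, G.map Cluster.entry = E → Summary T G →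
      ∃ G', G'.map Cluster.entry = E' ∧ Summary T G' ∧ members G' = members G := by
  induction hE with
  | refl => exact fun G hG h => ⟨G, hG, h, rfl⟩
  | tail _ hm ih =>
    intro G hG h
    obtain ⟨G₁, rfl, h₁, hm₁⟩ := ih G hG h
    obtain ⟨G₂, hG₂, h₂, hm₂⟩ := h₁.exists_of_merge hm
    exact ⟨G₂, hG₂, h₂, hm₂.trans hm₁⟩

/-- `E'` is a possible state after the arrival of the item `x` in the state `E`. -/
def Arrival (m : ℕ) (E : List Entry) (x : ℝ) (E' : List Entry) : Prop :=
  ∃ A F, E = A ++ F ∧ (∀ a ∈ A, a.val ≤ x) ∧ (∀ f ∈ F, x ≤ f.val) ∧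
    Relation.ReflTransGen (Merge ((weight E + 1) / m + 1)) (A ++ ⟨x, weight E / m, 1⟩ :: F) E' ∧
    Irreducible ((weight E + 1) / m + 1) E'

/-- The entries `E` are a valid irreducible summary of the stream `l`. -/
def Summarizes (m : ℕ) (l : List ℝ) (E : List Entry) : Prop :=
  ∃ G : List Cluster, G.map Cluster.entry = E ∧ Summary (l.length / m + 1) G ∧
    (members G).map Prod.fst = (l : Multiset ℝ) ∧
    (∀ b, (members G).countP (b ≤ ·.2) ≤ l.length - b * m) ∧ Irreducible (l.length / m + 1) E

theorem Summarizes.nil (m : ℕ) : Summarizes m [] [] :=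
  ⟨[], rfl, Summary.nil _, by simp, by simp, fun _ h => by simpa using h.length_lt⟩

theorem Summarizes.weight_eq {m : ℕ} {l : List ℝ} {E : List Entry} (h : Summarizes m l E) :
    weight E = l.length := by
  obtain ⟨G, rfl, -, hm, -⟩ := h
  have := congrArg Multiset.card hm
  rw [weight_map_entry]
  simpa using this

theorem exists_split_of_pairwise {E : List Entry} (h : E.Pairwise (·.val ≤ ·.val)) (x : ℝ) :
    ∃ A F, E = A ++ F ∧ (∀ a ∈ A, a.val ≤ x) ∧ ∀ f ∈ F, x ≤ f.val := by
  induction E with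
  | nil => exact ⟨[], [], by simp⟩
  | cons e E ih =>
    rw [List.pairwise_cons] at h
    rcases le_total e.val x with hx | hx
    · obtain ⟨A, F, rfl, hA, hF⟩ := ih h.2
      exact ⟨e :: A, F, rfl, by simpa using ⟨hx, hA⟩, hF⟩
    · exact ⟨[], e :: E, rfl, by simp, by simpa using ⟨hx, fun f hf => hx.trans (h.1 f hf)⟩⟩

theorem Summarizes.exists_arrival {m : ℕ} {l : List ℝ} {E : List Entry} (h : Summarizes m l E)
    (x : ℝ) : ∃ E', Arrival m E x E' := by
  obtain ⟨G, rfl, hG, -⟩ := h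
  obtain ⟨A, F, hE, hA, hF⟩ := exists_split_of_pairwise
    (E := G.map Cluster.entry) (List.pairwise_map.2 hG.sorted) x
  obtain ⟨E', h1, h2⟩ := exists_irreducible ((weight (G.map Cluster.entry) + 1) / m + 1)
    (A ++ ⟨x, weight (G.map Cluster.entry) / m, 1⟩ :: F)
  exact ⟨E', A, F, hE, hA, hF, h1, h2⟩

theorem Summarizes.arrival {m : ℕ} {l : List ℝ} {E E' : List Entry} {x : ℝ}
    (h : Summarizes m l E) (hE : Arrival m E x E') : Summarizes m (l ++ [x]) E' := by
  obtain ⟨A, F, hAF, hA, hF, hm, hirr⟩ := hE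
  rw [h.weight_eq] at hm hirr
  obtain ⟨G, rfl, hG, hl, hc, -⟩ := h
  obtain ⟨A, F, rfl, rfl, rfl⟩ := List.map_eq_append_iff.1 hAF
  have h1 := hG.insert (x := x) (fun a ha => hA _ (List.mem_map_of_mem ha))
    (fun f hf => hF _ (List.mem_map_of_mem hf))
  have h2 : Summary ((l.length + 1) / m + 1)
      (A ++ ⟨x, l.length / m, {(x, l.length / m)}⟩ :: F) := by
    -- The clock advances only when the new length is a multiple of `m`.
    rw [Nat.succ_div]
    split_ifs
    exacts [h1.succ, h1]
  obtain ⟨G', rfl, h3, h4⟩ := Summary.exists_of_reflTransGen hm _ (by simp [Cluster.entry]) h2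
  have h5 : members G' = (x, l.length / m) ::ₘ members (A ++ F) := by
    rw [h4]
    simp
  refine ⟨G', rfl, by simpa using h3, ?_, fun b => ?_, by simpa using hirr⟩
  · rw [h5, Multiset.map_cons, hl, ← Multiset.coe_add, add_comm]
    rfl
  · have h6 := hc b
    have h7 : b ≤ l.length / m → b * m ≤ l.length := fun hb =>
      (Nat.mul_le_mul_right m hb).trans (Nat.div_mul_le_self _ _)
    rw [h5, Multiset.countP_cons, List.length_append, List.length_singleton]
    split_ifs with hb
    · have := h7 hb
      omega
    · omega

/-! #### Properties of a valid summary -/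

theorem Summarizes.length_le {m : ℕ} (hm : 0 < m) {l : List ℝ} {E : List Entry}
    (h : Summarizes m l E) :
    E.length ≤ m + Nat.log 2 (l.length / m + 1) * (8 * m + 1) := by
  obtain ⟨G, rfl, hG, -, hc, hirr⟩ := h
  rw [List.length_map]
  refine hG.length_le hirr fun b => (hc b).trans ?_
  rw [Nat.sub_mul]
  have := Nat.lt_mul_div_succ l.length hm
  rw [mul_comm] at this
  omega

theorem Summarizes.mem {m : ℕ} {l : List ℝ} {E : List Entry} (h : Summarizes m l E) {e : Entry}
    (he : e ∈ E) : e.val ∈ l ∧ e.time ≤ l.length ∧ e.wt ≤ l.length := by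
  have hw := h.weight_eq
  obtain ⟨G, rfl, hG, hl, -, -⟩ := h
  have h1 : e.wt ≤ weight (G.map Cluster.entry) :=
    List.le_sum_of_mem (List.mem_map_of_mem he)
  obtain ⟨c, hc, rfl⟩ := List.mem_map.1 he
  refine ⟨?_, ?_, hw ▸ h1⟩
  · rw [← Multiset.mem_coe, ← hl]
    exact Multiset.mem_map.2 ⟨_, mem_members.2 ⟨c, hc, hG.self_mem c hc⟩, rfl⟩
  · have h2 := hG.cap c hc
    have h3 := hG.card_pos hc
    have h4 := Nat.div_le_self l.length m
    show c.time ≤ _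
    omega

/-- The items of the rounded instance that the entries stand for. -/
def items (E : List Entry) : Multiset ℝ := (E.map fun e => Multiset.replicate e.wt e.val).sum

@[simp] theorem items_nil : items [] = 0 := rfl

@[simp] theorem items_cons (e : Entry) (E : List Entry) :
    items (e :: E) = Multiset.replicate e.wt e.val + items E := by simp [items]

theorem Summary.rel_items {T : ℕ} {G : List Cluster} (h : Summary T G) :
    Multiset.Rel (· ≤ ·) ((members G).map Prod.fst) (items (G.map Cluster.entry)) := by
  induction G with
  | nil => exact Multiset.Rel.zero
  | cons c G ih =>
    rw [members_cons, Multiset.map_add, List.map_cons, items_cons]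
    refine Multiset.Rel.add (Multiset.rel_replicate_right.2 ⟨by simp [Cluster.entry], ?_⟩)
      (ih (h.of_suffix (List.suffix_cons c G)))
    intro y hy
    obtain ⟨w, hw, rfl⟩ := Multiset.mem_map.1 hy
    exact h.le_val c (by simp) w hw

/-- The excess consists of items below `z` represented by entries with value at least `z`. By
sortedness these entries form a suffix, and `cross_head` at its first entry bounds the excess. -/
theorem Summary.countP_items_le {T : ℕ} {G : List Cluster} (h : Summary (T + 1) G) (z : ℝ) :
    (items (G.map Cluster.entry)).countP (z ≤ ·) ≤
      (members G).countP (fun y => z ≤ y.1) + T := by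
  induction G with
  | nil => simp
  | cons c G ih =>
    rcases le_or_gt z c.val with hz | hz
    · have h1 := h.cross_head hz
      have h2 := Multiset.card_eq_countP_add_countP (fun y : ℝ × ℕ => z ≤ y.1)
        (members (c :: G))
      simp only [not_le] at h2
      have h3 := Multiset.countP_le_card (z ≤ ·) (items ((c :: G).map Cluster.entry))
      have h4 := Multiset.card_eq_card_of_rel h.rel_items
      rw [Multiset.card_map] at h4
      omega
    · have h1 := ih (h.of_suffix (List.suffix_cons c G))
      rw [List.map_cons, items_cons, Multiset.countP_add, members_cons, Multiset.countP_add]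
      have h2 : (Multiset.replicate c.entry.wt c.entry.val).countP (z ≤ ·) = 0 :=
        Multiset.countP_eq_zero.2 fun y hy => by
          rw [Multiset.eq_of_mem_replicate hy]
          exact not_le.2 hz
      omega

theorem Summarizes.rel_items {m : ℕ} {l : List ℝ} {E : List Entry} (h : Summarizes m l E) :
    Multiset.Rel (· ≤ ·) (l : Multiset ℝ) (items E) := by
  obtain ⟨G, rfl, hG, hl, -, -⟩ := h
  rw [← hl]
  exact hG.rel_items

theorem Summarizes.countP_items_le {m : ℕ} {l : List ℝ} {E : List Entry} (h : Summarizes m l E)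
    (z : ℝ) : (items E).countP (z ≤ ·) ≤ (l : Multiset ℝ).countP (z ≤ ·) + l.length / m := by
  obtain ⟨G, rfl, hG, hl, -, -⟩ := h
  have := hG.countP_items_le z
  rwa [← hl, Multiset.countP_map, ← Multiset.countP_eq_card_filter]

/-! ### The streaming algorithm -/

/-- The size class of `x`: the `j` with `2 ^ (-(j + 1)) < x ≤ 2 ^ (-j)`. -/
noncomputable def sizeClass (x : ℝ) : ℕ := Nat.log 2 ⌊1 / x⌋₊

open Classical in
/-- The state of a summary after the arrival of the item `x`. -/
noncomputable def nextEntries (m : ℕ) (E : List Entry) (x : ℝ) : List Entry :=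
  -- A choice depending only on the old state and the item keeps the algorithm deterministic; the
  -- default is never reached from a valid summary, by `Summarizes.exists_arrival`.
  if h : ∃ E', Arrival m E x E' then h.choose else []

theorem Summarizes.nextEntries {m : ℕ} {l : List ℝ} {E : List Entry} (h : Summarizes m l E)
    (x : ℝ) : Summarizes m (l ++ [x]) (nextEntries m E x) := by
  have hE := h.exists_arrival x
  rw [Sketch.nextEntries, dif_pos hE]
  exact h.arrival hE.choose_spec

/-- The summaries of the size classes are kept in one list. -/
noncomputable def nextAll (m : ℕ) (E : List Entry) (x : ℝ) : List Entry :=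
  nextEntries m (E.filter fun e => sizeClass e.val = sizeClass x) x ++
    E.filter fun e => sizeClass e.val ≠ sizeClass x

def SummarizesAll (m : ℕ) (l : List ℝ) (E : List Entry) : Prop :=
  ∀ j, Summarizes m (l.filter fun x => sizeClass x = j) (E.filter fun e => sizeClass e.val = j)

theorem SummarizesAll.nextAll {m : ℕ} {l : List ℝ} {E : List Entry} (h : SummarizesAll m l E)
    (x : ℝ) : SummarizesAll m (l ++ [x]) (nextAll m E x) := by
  intro j
  have h1 := (h (sizeClass x)).nextEntries x
  have h2 : ∀ e ∈ nextEntries m (E.filter fun e => sizeClass e.val = sizeClass x) x,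
      sizeClass e.val = sizeClass x := by
    intro e he
    have := (h1.mem he).1
    simp only [List.mem_append, List.mem_filter, List.mem_singleton, decide_eq_true_eq] at this
    rcases this with h | h
    exacts [h.2, by rw [h]]
  rw [Sketch.nextAll, List.filter_append, List.filter_append, List.filter_filter]
  by_cases hj : j = sizeClass x
  · subst hj
    have h3 : (E.filter fun e => decide (sizeClass e.val = sizeClass x) &&
        decide (sizeClass e.val ≠ sizeClass x)) = [] := by
      rw [List.filter_eq_nil_iff]
      simp
    have h4 : [x].filter (fun y => sizeClass y = sizeClass x) = [x] := by simp
    rw [h3, h4, List.append_nil, List.filter_eq_self.2 fun e he => decide_eq_true (h2 e he)]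
    exact h1
  · have h3 : (nextEntries m (E.filter fun e => sizeClass e.val = sizeClass x) x).filter
        (fun e => sizeClass e.val = j) = [] := by
      rw [List.filter_eq_nil_iff]
      intro e he
      simpa [h2 e he] using Ne.symm hj
    have h4 : (E.filter fun e => decide (sizeClass e.val = j) &&
        decide (sizeClass e.val ≠ sizeClass x)) = E.filter fun e => sizeClass e.val = j := by
      refine List.filter_congr fun e _ => ?_
      by_cases he : sizeClass e.val = j <;> simp [he, hj]
    have h5 : [x].filter (fun x => sizeClass x = j) = [] := by simpa using Ne.symm hj
    rw [h3, h4, h5, List.nil_append, List.append_nil]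
    exact h j

noncomputable def run (m : ℕ) (l : List ℝ) : List Entry := l.foldl (nextAll m) []

theorem summarizesAll_run (m : ℕ) (l : List ℝ) : SummarizesAll m l (run m l) := by
  induction l using List.reverseRecOn with
  | nil => exact fun j => Summarizes.nil m
  | append_singleton l x ih =>
    rw [run, List.foldl_append]
    exact ih.nextAll x

/-- An entry is stored in three words. -/
def encode (E : List Entry) : List MemWord :=
  E.flatMap fun e => [.item e.val, .num e.time, .num e.wt]

noncomputable def decode : List MemWord → List Entry
  | .item x :: .num s :: .num g :: w => ⟨x, s.toNat, g.toNat⟩ :: decode w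
  | _ => []

theorem decode_encode (E : List Entry) : decode (encode E) = E := by
  induction E with
  | nil => simp [encode, decode]
  | cons e E ih =>
    have : encode (e :: E) = .item e.val :: .num e.time :: .num e.wt :: encode E := by
      simp [encode]
    rw [this, decode, ih]
    simp

theorem length_encode (E : List Entry) : (encode E).length = 3 * E.length := by
  induction E with
  | nil => simp [encode]
  | cons e E ih =>
    have : encode (e :: E) = .item e.val :: .num e.time :: .num e.wt :: encode E := by
      simp [encode]
    rw [this]
    simp only [List.length_cons, ih]
    ring

/-- The streaming algorithm with precision `1 / m`. -/
noncomputable def alg (m : ℕ) : StreamAlg where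
  init := []
  update w x := encode (nextAll m (decode w) x)
  output w := ((decode w).map fun e => Finsupp.single e.val e.wt).sum

theorem state_alg (m : ℕ) (l : List ℝ) : (alg m).state l = encode (run m l) := by
  induction l using List.reverseRecOn with
  | nil => rfl
  | append_singleton l x ih =>
    rw [StreamAlg.state] at ih ⊢
    rw [List.foldl_append, ih]
    show encode (nextAll m (decode (encode (run m l))) x) = _
    rw [decode_encode, run, run, List.foldl_append]
    rfl

theorem items_result_alg (m : ℕ) (l : List ℝ) :
    ((alg m).result l).items = items (run m l) := by
  rw [StreamAlg.result, state_alg]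
  show Finsupp.toMultiset ((decode (encode (run m l))).map _).sum = _
  rw [decode_encode]
  induction run m l with
  | nil => simp
  | cons e E ih =>
    rw [List.map_cons, List.sum_cons, map_add, ih, items_cons, Finsupp.toMultiset_single,
      Multiset.nsmul_singleton]

theorem numSizes_result_alg_le (m : ℕ) (l : List ℝ) :
    ((alg m).result l).numSizes ≤ (run m l).length := by
  classical
  rw [StreamAlg.result, state_alg]
  show (Finsupp.support ((decode (encode (run m l))).map _).sum).card ≤ _
  rw [decode_encode]
  induction run m l with
  | nil => simp
  | cons e E ih =>
    rw [List.map_cons, List.sum_cons, List.length_cons]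
    refine (Finset.card_le_card Finsupp.support_add).trans ((Finset.card_union_le _ _).trans ?_)
    have h1 : (Finsupp.single e.val e.wt).support.card ≤ 1 :=
      (Finset.card_le_card Finsupp.support_single_subset).trans (by simp)
    omega

theorem mem_run {m : ℕ} {l : List ℝ} {e : Entry} (he : e ∈ run m l) :
    e.val ∈ l ∧ e.time ≤ l.length ∧ e.wt ≤ l.length := by
  have h := (summarizesAll_run m l (sizeClass e.val)).mem (e := e) (by simpa using he)
  have h1 := List.length_filter_le (fun x => decide (sizeClass x = sizeClass e.val)) l
  exact ⟨(List.mem_filter.1 h.1).1, h.2.1.trans h1, h.2.2.trans h1⟩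

theorem admissible_alg (m : ℕ) (l : List ℝ) : (alg m).Admissible 1 l := by
  intro n _ w hw
  rw [state_alg] at hw
  generalize l.take n = l at hw
  obtain ⟨e, he, hw⟩ := List.mem_flatMap.1 hw
  obtain ⟨h1, h2, h3⟩ := mem_run he
  have h2' : (e.time : ℤ) ≤ l.length := by exact_mod_cast h2
  have h3' : (e.wt : ℤ) ≤ l.length := by exact_mod_cast h3
  simp only [List.mem_cons, List.not_mem_nil, or_false] at hw
  rcases hw with rfl | rfl | rfl
  · exact h1
  · show |(e.time : ℤ)| ≤ _
    rw [abs_of_nonneg (by positivity)]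
    linarith
  · show |(e.wt : ℤ)| ≤ _
    rw [abs_of_nonneg (by positivity)]
    linarith

/-! #### Summing over the size classes -/

theorem sum_map_eq_sum_filter {α M : Type*} [AddCommMonoid M] (g : α → M) (f : α → ℕ) {K : ℕ}
    (l : List α) (h : ∀ x ∈ l, f x < K) :
    (l.map g).sum = ∑ j ∈ Finset.range K, ((l.filter fun x => f x = j).map g).sum := by
  induction l with
  | nil => simp
  | cons a l ih =>
    rw [List.map_cons, List.sum_cons, ih fun x hx => h x (by simp [hx])]
    have : ∀ j, (((a :: l).filter fun x => f x = j).map g).sum =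
        (if f a = j then g a else 0) + ((l.filter fun x => f x = j).map g).sum := by
      intro j
      rw [List.filter_cons]
      by_cases hj : f a = j <;> simp [hj]
    simp only [this, Finset.sum_add_distrib]
    rw [Finset.sum_ite_eq, if_pos (Finset.mem_range.2 (h a (by simp)))]

theorem coe_eq_sum_filter (f : ℝ → ℕ) {K : ℕ} (l : List ℝ) (h : ∀ x ∈ l, f x < K) :
    (l : Multiset ℝ) =
      ∑ j ∈ Finset.range K, ((l.filter fun x => f x = j : List ℝ) : Multiset ℝ) := by
  have key : ∀ l : List ℝ, (l.map fun x => ({x} : Multiset ℝ)).sum = l := by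
    intro l
    induction l with
    | nil => simp
    | cons a l ih => simp [ih]
  rw [← key l, sum_map_eq_sum_filter _ f l h]
  exact Finset.sum_congr rfl fun j _ => key _

theorem items_eq_sum_filter {K : ℕ} (E : List Entry) (h : ∀ e ∈ E, sizeClass e.val < K) :
    items E = ∑ j ∈ Finset.range K, items (E.filter fun e => sizeClass e.val = j) := by
  unfold items
  exact sum_map_eq_sum_filter (fun e : Entry => Multiset.replicate e.wt e.val)
    (fun e => sizeClass e.val) E h

theorem length_eq_sum_filter {K : ℕ} (E : List Entry) (h : ∀ e ∈ E, sizeClass e.val < K) :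
    E.length = ∑ j ∈ Finset.range K, (E.filter fun e => sizeClass e.val = j).length := by
  have := sum_map_eq_sum_filter (fun _ => 1) (fun e => sizeClass e.val) E h
  simpa using this

theorem le_of_sizeClass {x : ℝ} (h0 : 0 < x) (h1 : x ≤ 1) : x ≤ 1 / (2 ^ sizeClass x : ℕ) := by
  have h2 : 1 ≤ ⌊1 / x⌋₊ := Nat.le_floor (by rw [Nat.cast_one, le_div_iff₀ h0]; linarith)
  have h3 : 2 ^ sizeClass x ≤ ⌊1 / x⌋₊ := Nat.pow_log_le_self 2 (by omega)
  have h4 : ((2 ^ sizeClass x : ℕ) : ℝ) ≤ 1 / x :=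
    (Nat.cast_le.2 h3).trans (Nat.floor_le (by positivity))
  rwa [le_div_iff₀ (by positivity), mul_comm, ← le_div_iff₀ h0]

theorem lt_of_sizeClass {x : ℝ} (h0 : 0 < x) : 1 < 2 * (2 : ℝ) ^ sizeClass x * x := by
  have h1 : ⌊1 / x⌋₊ < 2 ^ (sizeClass x + 1) := Nat.lt_pow_succ_log_self (by norm_num) _
  have h2 : 1 / x < 2 ^ (sizeClass x + 1) := by
    have := (Nat.floor_lt (by positivity)).1 h1
    exact_mod_cast this
  rw [div_lt_iff₀ h0, pow_succ] at h2
  linarith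

theorem sizeClass_le {x ε : ℝ} (hε : 0 < ε) (hx : ε < x) : sizeClass x ≤ sizeClass ε :=
  Nat.log_mono_right (Nat.floor_mono (one_div_le_one_div_of_le hε hx.le))

theorem sizeClass_le_log {ε : ℝ} (hε : 0 < ε) (hε1 : ε < 1) :
    sizeClass ε ≤ 2 * Real.log (1 / ε) := by
  have h1 := le_of_sizeClass hε hε1.le
  rw [le_div_iff₀ (by positivity), mul_comm, ← le_div_iff₀ hε] at h1
  have h2 := Real.log_le_log (by positivity) h1
  rw [Nat.cast_pow, Real.log_pow] at h2
  have h3 : (1 : ℝ) / 2 ≤ Real.log (2 : ℕ) := by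
    have := Real.log_two_gt_d9
    norm_num at this ⊢
    linarith
  nlinarith [Nat.cast_nonneg (α := ℝ) (sizeClass ε)]

theorem rel_finset_sum {ι α β : Type*} {r : α → β → Prop} (s : Finset ι)
    {f : ι → Multiset α} {g : ι → Multiset β} (h : ∀ i ∈ s, Multiset.Rel r (f i) (g i)) :
    Multiset.Rel r (∑ i ∈ s, f i) (∑ i ∈ s, g i) := by
  classical
  induction s using Finset.induction_on with
  | empty => exact Multiset.Rel.zero
  | insert a s ha ih =>
    rw [Finset.sum_insert ha, Finset.sum_insert ha]
    exact (h a (by simp)).add (ih fun i hi => h i (by simp [hi]))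

theorem sum_finset_sum {ι : Type*} (s : Finset ι) (f : ι → Multiset ℝ) :
    (∑ i ∈ s, f i).sum = ∑ i ∈ s, (f i).sum :=
  map_sum (Multiset.sumAddMonoidHom : Multiset ℝ →+ ℝ) f s

theorem sum_le_sum_of_le {I J : Multiset ℝ} (h : I ≤ J) (hJ : ∀ x ∈ J, 0 ≤ x) :
    I.sum ≤ J.sum := by
  obtain ⟨X, rfl⟩ := Multiset.le_iff_exists_add.1 h
  rw [Multiset.sum_add]
  have : 0 ≤ X.sum := Multiset.sum_nonneg fun x hx => hJ x (by simp [hx])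
  linarith

theorem mem_items {E : List Entry} {x : ℝ} (hx : x ∈ items E) : ∃ e ∈ E, e.val = x := by
  induction E with
  | nil => simp at hx
  | cons e E ih =>
    rw [items_cons, Multiset.mem_add] at hx
    rcases hx with hx | hx
    · exact ⟨e, by simp, (Multiset.eq_of_mem_replicate hx).symm⟩
    · obtain ⟨e', he', rfl⟩ := ih hx
      exact ⟨e', by simp [he'], rfl⟩

/-- Many items of a size class have a large total size. -/
theorem length_le_of_sizeClass {l : List ℝ} {j : ℕ} (h : ∀ x ∈ l, 0 < x ∧ sizeClass x = j) :
    (l.length : ℝ) ≤ 2 * 2 ^ j * (l : Multiset ℝ).sum := by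
  induction l with
  | nil => simp
  | cons x l ih =>
    have h1 := ih fun y hy => h y (by simp [hy])
    obtain ⟨h2, rfl⟩ := h x (by simp)
    have h3 := lt_of_sizeClass h2
    simp only [Multiset.sum_coe, List.sum_cons, List.length_cons] at h1 ⊢
    push_cast
    linarith

/-- Within a size class, a summary of precision `1 / m` exceeds the stream only by few items and
by a part that is dominated by the stream. -/
theorem Summarizes.exists_split {m j : ℕ} {ε : ℝ} (hm : 2 ≤ ε * m) (hε : 0 < ε) {l : List ℝ}
    {E : List Entry} (h : Summarizes m l E) (hl : ∀ x ∈ l, 0 < x ∧ x ≤ 1 ∧ sizeClass x = j) :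
    ∃ S R I' : Multiset ℝ, items E = S + R ∧ I' ≤ (l : Multiset ℝ) ∧
      Multiset.Rel (· ≤ ·) R I' ∧ (∀ x ∈ S, x ≤ 1) ∧ S.sum ≤ ε * (l : Multiset ℝ).sum ∧
      (OPT S : ℝ) ≤ ε * (l : Multiset ℝ).sum + if j = 0 then 0 else 1 := by
  obtain ⟨S, R, I', hE, hS, hI', hR⟩ := exists_split_of_countP_le h.countP_items_le
  have hSx : ∀ x ∈ S, x ≤ 1 / ((2 ^ j : ℕ) : ℝ) := by
    intro x hx
    obtain ⟨e, he, rfl⟩ := mem_items (E := E) (x := x) (by rw [hE]; simp [hx])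
    obtain ⟨h0, h1, rfl⟩ := hl _ (h.mem he).1
    exact le_of_sizeClass h0 h1
  have hj : (0 : ℝ) < 2 ^ j := by positivity
  -- Combine `S.card ≤ length / m`, `2 ≤ ε * m` and `length ≤ 2 * 2 ^ j * sum`: the two factors `2`
  -- cancel.
  have hcard : (S.card : ℝ) ≤ 2 ^ j * (ε * (l : Multiset ℝ).sum) := by
    have h1 : (S.card : ℝ) * m ≤ l.length := by
      exact_mod_cast (Nat.mul_le_mul_right m hS).trans (Nat.div_mul_le_self _ _)
    have h2 := length_le_of_sizeClass (j := j) fun x hx => ⟨(hl x hx).1, (hl x hx).2.2⟩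
    have h3 : (S.card : ℝ) * 2 ≤ S.card * (ε * m) :=
      mul_le_mul_of_nonneg_left hm (Nat.cast_nonneg _)
    have h4 := mul_le_mul_of_nonneg_left (h1.trans h2) hε.le
    linarith
  refine ⟨S, R, I', hE, hI', hR, fun x hx => (hSx x hx).trans ?_, ?_, ?_⟩
  · rw [div_le_one (by positivity)]
    exact_mod_cast Nat.one_le_two_pow
  · refine (Multiset.sum_le_card_nsmul S _ hSx).trans ?_
    rw [nsmul_eq_mul, mul_one_div, div_le_iff₀ (by positivity)]
    push_cast
    linarith
  · have h1 := mul_OPT_le (Nat.two_pow_pos j) _ S rfl hSx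
    have h2 : (2 : ℝ) ^ j * OPT S + 1 ≤ S.card + 2 ^ j := by exact_mod_cast h1
    -- For `j = 0` there is one item per bin and no partly filled last bin.
    split_ifs with h0
    · subst h0
      simp only [pow_zero, one_mul] at h2 hcard
      linarith
    · have h3 : (2 : ℝ) ^ j * OPT S ≤ 2 ^ j * (ε * (l : Multiset ℝ).sum + 1) := by linarith
      exact le_of_mul_le_mul_left h3 hj

/-! ### Rounding error and memory over a whole run -/

section

variable {m : ℕ} {ε : ℝ} {l : List ℝ}

theorem sizeClass_lt (hε : 0 < ε) (hl : ∀ x ∈ l, ε < x ∧ x ≤ 1) :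
    ∀ x ∈ l, sizeClass x < sizeClass ε + 1 :=
  fun x hx => Nat.lt_succ_of_le (sizeClass_le hε (hl x hx).1)

theorem rel_items_run (hε : 0 < ε) (hl : ∀ x ∈ l, ε < x ∧ x ≤ 1) :
    Multiset.Rel (· ≤ ·) (l : Multiset ℝ) (items (run m l)) := by
  have hc := sizeClass_lt hε hl
  rw [coe_eq_sum_filter sizeClass l hc,
    items_eq_sum_filter (run m l) fun e he => hc _ (mem_run he).1]
  exact rel_finset_sum _ fun j _ => (summarizesAll_run m l j).rel_items

theorem OPT_items_run_le (hε : 0 < ε) (hm : 2 ≤ ε * m) (hl : ∀ x ∈ l, ε < x ∧ x ≤ 1) :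
    (OPT (items (run m l)) : ℝ) ≤ (1 + ε) * OPT l + sizeClass ε ∧
      SIZE (items (run m l)) ≤ (1 + ε) * SIZE l := by
  have hc := sizeClass_lt hε hl
  have hsplit := fun j => (summarizesAll_run m l j).exists_split (j := j) hm hε (by
    intro x hx
    rw [List.mem_filter, decide_eq_true_eq] at hx
    exact ⟨hε.trans (hl x hx.1).1, (hl x hx.1).2, hx.2⟩)
  choose S R I' hE hI' hR hS1 hS hSO using hsplit
  set K := sizeClass ε + 1 with hK
  have hsum := coe_eq_sum_filter sizeClass l hc
  have hitems : items (run m l) = ∑ j ∈ Finset.range K, S j + ∑ j ∈ Finset.range K, R j := by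
    rw [items_eq_sum_filter (run m l) fun e he => hc _ (mem_run he).1, ← Finset.sum_add_distrib]
    exact Finset.sum_congr rfl fun j _ => hE j
  have hle : ∑ j ∈ Finset.range K, I' j ≤ (l : Multiset ℝ) := by
    rw [hsum]
    exact Finset.sum_le_sum fun j _ => hI' j
  have hrel := rel_finset_sum (Finset.range K) (fun j _ => hR j)
  have hl0 : ∀ x ∈ (l : Multiset ℝ), 0 ≤ x ∧ x ≤ 1 := fun x hx =>
    ⟨(hε.trans (hl x hx).1).le, (hl x hx).2⟩
  have hI1 : ∀ x ∈ ∑ j ∈ Finset.range K, I' j, x ≤ 1 := fun x hx =>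
    (hl0 x (Multiset.mem_of_le hle hx)).2
  have hsum' : ∑ j ∈ Finset.range K, ((l.filter fun x => sizeClass x = j : List ℝ) :
      Multiset ℝ).sum = (l : Multiset ℝ).sum := by
    conv_rhs => rw [hsum]
    exact (sum_finset_sum _ _).symm
  constructor
  · have h1 : (OPT (∑ j ∈ Finset.range K, S j) : ℝ) ≤ ε * (l : Multiset ℝ).sum + sizeClass ε := by
      calc (OPT (∑ j ∈ Finset.range K, S j) : ℝ)
          ≤ ∑ j ∈ Finset.range K, (OPT (S j) : ℝ) := by
            exact_mod_cast OPT_sum_le _ _ fun j _ => hS1 j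
        _ ≤ ∑ j ∈ Finset.range K, (ε * ((l.filter fun x => sizeClass x = j : List ℝ) :
              Multiset ℝ).sum + if j = 0 then 0 else 1) := Finset.sum_le_sum fun j _ => hSO j
        _ = _ := by
            -- Of the `sizeClass ε + 1` classes, all but class `0` contribute an extra bin.
            rw [Finset.sum_add_distrib, ← Finset.mul_sum, hsum', hK, Finset.sum_range_succ']
            simp
    have h2 : OPT (∑ j ∈ Finset.range K, R j) ≤ OPT l :=
      (OPT_le_of_rel hrel hI1).trans (OPT_mono hle hl0)
    have h3 : OPT (items (run m l)) ≤ OPT (∑ j ∈ Finset.range K, S j) +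
        OPT (∑ j ∈ Finset.range K, R j) := by
      rw [hitems]
      refine OPT_add_le (fun x hx => ?_) fun x hx => ?_
      · obtain ⟨j, -, hx⟩ := Multiset.mem_sum.1 hx
        exact hS1 j x hx
      · obtain ⟨y, hy, hxy⟩ := Multiset.exists_mem_of_rel_of_mem hrel hx
        exact le_trans hxy (hI1 y hy)
    have h4 : (OPT (items (run m l)) : ℝ) ≤ OPT (∑ j ∈ Finset.range K, S j) + OPT l := by
      exact_mod_cast h3.trans (Nat.add_le_add_left h2 _)
    have h5 := mul_le_mul_of_nonneg_left (SIZE_le_OPT fun x hx => (hl0 x hx).2) hε.le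
    rw [SIZE] at h5
    linarith
  · have h1 : (∑ j ∈ Finset.range K, S j).sum ≤ ε * (l : Multiset ℝ).sum := by
      rw [← hsum', Finset.mul_sum]
      refine (sum_finset_sum _ S).trans_le ?_
      exact Finset.sum_le_sum fun j _ => hS j
    have h2 := (sum_le_sum_of_rel hrel).trans (sum_le_sum_of_le hle fun x hx => (hl0 x hx).1)
    rw [SIZE, SIZE, hitems, Multiset.sum_add]
    linarith

theorem length_run_le (hε : 0 < ε) (hm : 0 < m) (hl : ∀ x ∈ l, ε < x ∧ x ≤ 1) {T : ℕ}
    (hT : l.length / m + 1 ≤ T) :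
    (run m l).length ≤ (sizeClass ε + 1) * (m + Nat.log 2 T * (8 * m + 1)) := by
  have hc := sizeClass_lt hε hl
  rw [length_eq_sum_filter (run m l) fun e he => hc _ (mem_run he).1]
  refine (Finset.sum_le_card_nsmul _ _ (m + Nat.log 2 T * (8 * m + 1)) fun j _ => ?_).trans
    (by simp)
  refine ((summarizesAll_run m l j).length_le hm).trans ?_
  gcongr
  exact (Nat.add_le_add_right (Nat.div_le_div_right (List.length_filter_le _ _)) 1).trans hT

theorem log_two_le (n : ℕ) : (Nat.log 2 (n + 1) : ℝ) ≤ 2 * (1 + Real.log n) := by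
  rcases Nat.eq_zero_or_pos n with rfl | hn
  · simp
  have h1 : 2 ^ Nat.log 2 (n + 1) ≤ n + 1 := Nat.pow_log_le_self 2 (by omega)
  have h2 : ((2 : ℝ)) ^ Nat.log 2 (n + 1) ≤ 2 * n := by
    have : 2 ^ Nat.log 2 (n + 1) ≤ 2 * n := by omega
    exact_mod_cast this
  have hn' : (n : ℝ) ≠ 0 := by positivity
  have h3 := Real.log_le_log (by positivity) h2
  rw [Real.log_pow, Real.log_mul (by norm_num) hn'] at h3
  have h4 := Real.log_two_gt_d9
  have h5 := Real.log_two_lt_d9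
  have h6 := Real.log_natCast_nonneg n
  nlinarith [Nat.cast_nonneg (α := ℝ) (Nat.log 2 (n + 1))]

/-- The constant is `342 = 3 * 2 * 3 * 19`: three words per entry, at most `2 * (1 + log (1 / ε))`
classes, `m ≤ 3 / ε`, and `1 + 9 * Λ ≤ 19 * (1 + log n)` with `Λ = Nat.log 2 (n + 1)`. -/
theorem words_le {n : ℕ} (hε : 0 < ε) (hε1 : ε < 1) (hm : (m : ℝ) ≤ 3 / ε) (hm0 : 0 < m) :
    ((3 * ((sizeClass ε + 1) * (m + Nat.log 2 (n + 1) * (8 * m + 1))) : ℕ) : ℝ) ≤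
      342 * ((1 / ε) * (1 + Real.log (1 / ε)) * (1 + Real.log n)) := by
  have h1 := sizeClass_le_log hε hε1
  have h2 := log_two_le n
  have h3 := Real.log_natCast_nonneg n
  have h4 : 0 ≤ Real.log (1 / ε) := Real.log_nonneg (by rw [le_div_iff₀ hε]; linarith)
  have h5 : (1 : ℝ) ≤ m := by exact_mod_cast hm0
  push_cast
  set L := Real.log (1 / ε)
  set Q := Real.log n
  set Λ : ℝ := ((Nat.log 2 (n + 1) : ℕ) : ℝ)
  have h6 : 0 ≤ Λ := Nat.cast_nonneg _
  have h7 : m + Λ * (8 * m + 1) ≤ (3 / ε) * (19 * (1 + Q)) := by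
    have h8 : m + Λ * (8 * m + 1) ≤ m * (1 + 9 * Λ) := by nlinarith
    have h9 : m * (1 + 9 * Λ) ≤ m * (19 * (1 + Q)) :=
      mul_le_mul_of_nonneg_left (by linarith) (by linarith)
    exact h8.trans (h9.trans (mul_le_mul_of_nonneg_right hm (by linarith)))
  calc 3 * (((sizeClass ε : ℝ) + 1) * (m + Λ * (8 * m + 1)))
      ≤ 3 * ((2 * (1 + L)) * ((3 / ε) * (19 * (1 + Q)))) := by
        refine mul_le_mul_of_nonneg_left (mul_le_mul (by linarith) h7 ?_ (by linarith))
          (by norm_num)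
        have := mul_nonneg h6 (by linarith : (0 : ℝ) ≤ 8 * m + 1)
        linarith
    _ = _ := by ring

end

end Sketch

open Sketch

theorem lemma1 :
    ∃ C : ℝ, 0 < C ∧ ∃ c : ℕ, ∀ ε : ℝ, 0 < ε → ε < 1 →
      ∃ A : StreamAlg, ∀ s : List ℝ, (∀ x ∈ s, ε < x ∧ x ≤ 1) →
        ∀ (IB : Multiset ℝ) (IR : HMInstance) (σ : ℝ),
          IB = (s : Multiset ℝ) → IR = A.result s →
          σ = C * ((1 / ε) * (1 + Real.log (1 / ε)) * (1 + Real.log (OPT IB))) →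
          -- the memory holds words only, and at most `σ` of them
          A.Admissible c s ∧ (A.memory s : ℝ) ≤ σ ∧
          -- at most `σ` sizes, all of them larger than `ε` (and at most the bin capacity)
          (IR.numSizes : ℝ) ≤ σ ∧ (∀ x ∈ IR.items, ε < x ∧ x ≤ 1) ∧
          -- sizes are rounded up, so that packings of `IR` can be used for `IB`
          RoundedUp IB IR.items ∧
          (∀ P, IsPacking IR.items P →
            ∃ Q, IsPacking IB Q ∧ Multiset.Rel (Multiset.Rel (· ≤ ·)) Q P) ∧
          OPT IB ≤ OPT IR.items ∧ SIZE IB ≤ SIZE IR.items ∧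
          -- the optimum grows little
          (OPT IR.items : ℝ) ≤ (1 + ε) * OPT IB + C * Real.log (1 / ε) ∧
          -- the total size grows little
          SIZE IR.items ≤ (1 + ε) * SIZE IB := by
  refine ⟨342, by norm_num, 1, fun ε hε hε1 => ?_⟩
  -- The `2` in `2 / ε` compensates for the ratio `2` between the sizes within a class.
  obtain ⟨m, hm⟩ : ∃ m : ℕ, m = ⌈2 / ε⌉₊ := ⟨_, rfl⟩
  have hm2 : 2 ≤ ε * m := by
    have := Nat.le_ceil (2 / ε)
    rw [← hm, div_le_iff₀ hε] at this
    linarith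
  have hm0 : 0 < m := by
    rw [hm, Nat.ceil_pos]
    positivity
  have hm3 : (m : ℝ) ≤ 3 / ε := by
    have h1 := Nat.ceil_lt_add_one (show 0 ≤ 2 / ε by positivity)
    have h2 : (1 : ℝ) ≤ 1 / ε := by rw [le_div_iff₀ hε]; linarith
    have h3 : 3 / ε = 2 / ε + 1 / ε := by ring
    rw [← hm] at h1
    linarith
  refine ⟨alg m, ?_⟩
  rintro s hs _ _ σ rfl rfl hσ
  have hrel := rel_items_run (m := m) hε hs
  have hitems : ∀ x ∈ items (run m s), ε < x ∧ x ≤ 1 := by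
    intro x hx
    obtain ⟨e, he, rfl⟩ := mem_items hx
    exact hs _ (mem_run he).1
  -- All items exceed `ε`, so `OPT` is at least `ε` times the length: the number of clock ticks is
  -- bounded by `OPT`.
  have hdiv : s.length / m ≤ OPT s := by
    refine Nat.div_le_of_le_mul ?_
    have h1 := card_mul_le_OPT (I := (s : Multiset ℝ)) hs
    rw [Multiset.coe_card] at h1
    have h2 : (s.length : ℝ) * 1 ≤ s.length * (ε * m) :=
      mul_le_mul_of_nonneg_left (by linarith) (Nat.cast_nonneg _)
    have h3 := mul_le_mul_of_nonneg_right h1 (Nat.cast_nonneg (α := ℝ) m)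
    have h4 : (s.length : ℝ) ≤ m * OPT s := by linarith
    exact_mod_cast h4
  have hrun : ∀ n, (run m (s.take n)).length ≤
      (sizeClass ε + 1) * (m + Nat.log 2 (OPT s + 1) * (8 * m + 1)) := by
    intro n
    refine length_run_le hε hm0 (fun x hx => hs x (List.mem_of_mem_take hx)) ?_
    -- A prefix is no longer than the stream, so the clock bound `OPT + 1` of the whole stream holds
    -- at all times.
    refine Nat.add_le_add_right (le_trans (Nat.div_le_div_right ?_) hdiv) 1
    exact (List.take_sublist n s).length_le
  have hwords := words_le (n := OPT s) hε hε1 hm3 hm0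
  rw [← hσ] at hwords
  obtain ⟨hOPT, hSIZE⟩ := OPT_items_run_le hε hm2 hs
  rw [items_result_alg]
  refine ⟨admissible_alg m s, (Nat.cast_le.2 ?_).trans hwords, (Nat.cast_le.2 ?_).trans hwords,
    hitems, roundedUp_of_rel hrel, fun P hP => hP.exists_of_rel hrel,
    OPT_le_of_rel hrel fun x hx => (hitems x hx).2, sum_le_sum_of_rel hrel, ?_, hSIZE⟩
  · refine Finset.sup_le fun n _ => ?_
    rw [state_alg, length_encode]
    exact Nat.mul_le_mul_left 3 (hrun n)
  · have h1 := hrun s.length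
    rw [List.take_length] at h1
    exact (numSizes_result_alg_le m s).trans (h1.trans (by omega))
  · have h1 := sizeClass_le_log hε hε1
    have h2 : 0 ≤ Real.log (1 / ε) := Real.log_nonneg (by rw [le_div_iff₀ hε]; linarith)
    linarith
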